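/- Let $k\ge 2$ be an integer and let $K\subset\mathbb C$ be a compact set with convex hull $L=\mathrm{co}(K)$ (so $L=K$ if $K$ is convex). For every integer $p\ge k$ let $Q_{2,p},Q_{1,p}\in\mathbb C[z]$ satisfy $$Q_{2,p}(z)=\prod_{l=1}^p (z-\zeta_{l,p}),\qquad \frac{Q_{1,p}(z)}{Q_{2,p}(z)}=\sum_{l=1}^p\frac{a_{l,p}}{z-\zeta_{l,p}},\qquad \zeta_{l,p}\in K,\ a_{l,p}>0$$ (the $\zeta_{l,p}$ need not be distinct). For every $p\ge k$ let $n(p)\in\mathbb N$, let $S_p$ be a monic polynomial of degree $n(p)$ and let $V_p$ be a monic polynomial of degree $p-k$ such that $V_p$ is a higher Van Vleck polynomial divided by its leading coefficient and $S_p$ is a corresponding higher Heine–Stieltjes polynomial; that is, for some $c_p\in\mathbb C\setminus\{0\}$, $$Q_{2,p}\,S_p^{(k)}+Q_{1,p}\,S_p^{(k-1)}+c_p\,V_p\,S_p=0 .$$ For a nonconstant polynomial $P$ let $\mu_P=\frac1{\deg P}\sum_{\zeta}\delta_\zeta$ be its root-counting measure (zeros $\zeta$ of $P$ counted with multiplicity),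 and let $\mathcal M(L)$ be the set of Borel probability measures supported in $L$, with the weak-* topology (convergence against all real continuous functions on $L$). Then $\mu_{Q_{2,p}}\in\mathcal M(L)$ for $p\ge k$ and $\mu_{V_p}\in\mathcal M(L)$ for $p>k$; every infinite subset of $\mathbb N$ contains an infinite subset $\Gamma$ along which both $\mu_{V_p}$ and $\mu_{Q_{2,p}}$ converge weak-* in $\mathcal M(L)$; and whenever $\Gamma\subset\mathbb N$ is infinite and $${}_*\mu_V=\lim_{\Gamma\ni p\to\infty}^{*}\mu_{V_p},\qquad {}_*\mu_{Q_2}=\lim_{\Gamma\ni p\to\infty}^{*}\mu_{Q_{2,p}}$$ exist in $\mathcal M(L)$, the following hold. 1. ${}_*\mu_V\prec{}_*\mu_{Q_2}$ in the Choquet order on $L$, i.e. $\int_L f\,d\,{}_*\mu_V\le\int_L f\,d\,{}_*\mu_{Q_2}$ for every continuous convex $f:L\to\mathbb R$. 2. There is a dilation $T$ on $L$ with ${}_*\mu_{Q_2}=T({}_*\mu_V)$: a map $x\mapsto T_x\in\mathcal M(L)$ on $L$ such that $T_x$ has barycenter $x$ for all $x\in L$, $x\mapsto\int_L f\,dT_x$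 is Borel for every real continuous $f$ on $L$, and $\int_L f\,d\,{}_*\mu_{Q_2}=\int_L\big(\int_L f\,dT_x\big)\,d\,{}_*\mu_V(x)$ for all such $f$. 3. $\int|w|^m\,d\,{}_*\mu_V(w)\le\int|w|^m\,d\,{}_*\mu_{Q_2}(w)$ for every integer $m\ge0$. 4. $\int\log|z-w|\,d\,{}_*\mu_V(w)\ge\int\log|z-w|\,d\,{}_*\mu_{Q_2}(w)$ for every $z\in\mathbb C\setminus L$. -/

import Mathlib

open MeasureTheory Filter Topology

namespace HigherLame

/-- The pair `(Q₂, Q₁)` has the form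
`Q₂(z) = ∏ (z - ζ_l)`, `Q₁(z) / Q₂(z) = ∑ a_l / (z - ζ_l)` with `a_l > 0`, `1 ≤ l ≤ p`.
The `ζ_l` need not be distinct; the second identity is one of rational functions, i.e. it holds
wherever `Q₂` does not vanish. -/
def IsLameCoeffs (p : ℕ) (Q₂ Q₁ : Polynomial ℂ) : Prop :=
  ∃ (ζ : Fin p → ℂ) (a : Fin p → ℝ), (∀ l, 0 < a l) ∧
    Q₂ = ∏ l, (Polynomial.X - Polynomial.C (ζ l)) ∧
    ∀ z : ℂ, Q₂.eval z ≠ 0 → Q₁.eval z / Q₂.eval z = ∑ l, (a l : ℂ) / (z - ζ l)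

/-- `W` is a higher Van Vleck polynomial (of degree at most the Fuchs index `r = p - k`) and `S`
is a corresponding higher Heine-Stieltjes polynomial of degree `n` for the order `k` Lamé equation
`Q₂ y^(k) + Q₁ y^(k-1) + W y = 0`, where `deg Q₂ = p`. -/
structure IsSpectralPair (k p n : ℕ) (Q₂ Q₁ W S : Polynomial ℂ) : Prop where
  fuchs : k ≤ p
  degree_W : W.natDegree ≤ p - k
  S_ne_zero : S ≠ 0
  degree_S : S.natDegree = n
  equation : Q₂ * Polynomial.derivative^[k] S + Q₁ * Polynomial.derivative^[k - 1] S + W * S = 0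

/-- `S` is a monic higher Heine-Stieltjes polynomial of degree `n` and `V` is a corresponding
higher Van Vleck polynomial, of degree exactly `p - k`, divided by its leading coefficient so as
to be monic. -/
structure IsNormalizedSpectralPair (k p n : ℕ) (Q₂ Q₁ V S : Polynomial ℂ) : Prop where
  monic_S : S.Monic
  monic_V : V.Monic
  degree_V : V.natDegree = p - k
  pair : ∃ W : Polynomial ℂ, IsSpectralPair k p n Q₂ Q₁ W S ∧
    V = Polynomial.C W.leadingCoeff⁻¹ * W

/-- The root-counting measure `|Z(P)|⁻¹ ∑_{ζ ∈ Z(P)} δ_ζ` of a polynomial `P` of degree at least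
one, zeros being counted with multiplicity. -/
noncomputable def rootMeasure (P : Polynomial ℂ) : Measure ℂ :=
  (Multiset.card P.roots : ENNReal)⁻¹ • (P.roots.map fun ζ => Measure.dirac ζ).sum

/-- `M(L)`: the Borel probability measures on `ℂ` that are concentrated on `L`; for closed `L`
this means that the support is contained in `L`. -/
def probOn (L : Set ℂ) : Set (Measure ℂ) :=
  {μ | IsProbabilityMeasure μ ∧ μ Lᶜ = 0}

/-- `μ ∈ M(L)` is the weak-* limit of `ν p` as `p → ∞` within `Γ ⊆ ℕ`: one has
`ν_p(f) → μ(f)` for every real continuous function `f` on `L`. -/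
def IsWeakStarLimit (L : Set ℂ) (Γ : Set ℕ) (ν : ℕ → Measure ℂ) (μ : Measure ℂ) : Prop :=
  μ ∈ probOn L ∧
    ∀ f : ℂ → ℝ, ContinuousOn f L →
      Tendsto (fun p => ∫ w in L, f w ∂(ν p)) (atTop ⊓ 𝓟 Γ) (𝓝 (∫ w in L, f w ∂μ))

/-- The Choquet order `μ ≺ ν` for measures on `L`: one has `μ(f) ≤ ν(f)` for all continuous convex
functions `f : L → ℝ`. -/
def ChoquetLE (L : Set ℂ) (μ ν : Measure ℂ) : Prop :=
  ∀ f : ℂ → ℝ, ContinuousOn f L → ConvexOn ℝ L f → ∫ w in L, f w ∂μ ≤ ∫ w in L, f w ∂ν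

/-- `T`, considered on `L` only, is a dilation on `L`: a weakly Borel measurable `M(L)`-valued map
on `L` with `T x` having barycenter `x` for every `x ∈ L`. -/
structure IsDilation (L : Set ℂ) (T : ℂ → Measure ℂ) : Prop where
  mem_probOn : ∀ x ∈ L, T x ∈ probOn L
  barycenter : ∀ x ∈ L, ⨍ w in L, w ∂(T x) = x
  measurable : ∀ f : ℂ → ℝ, ContinuousOn f L → Measurable fun x : L => ∫ w in L, f w ∂(T x)

/-- `ν = T(μ)`: one has `ν(f) = ∫_L T_x(f) dμ(x)` for every real continuous function `f` on `L`. -/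
def IsDilationOf (L : Set ℂ) (T : ℂ → Measure ℂ) (μ ν : Measure ℂ) : Prop :=
  ∀ f : ℂ → ℝ, ContinuousOn f L → ∫ w in L, f w ∂ν = ∫ x in L, (∫ w in L, f w ∂(T x)) ∂μ

/-- The moment `∫ |w|^m dμ(w)`. -/
noncomputable def moment (μ : Measure ℂ) (m : ℕ) : ℝ := ∫ w, ‖w‖ ^ m ∂μ

/-- The logarithmic potential `U^μ(z) = ∫ log |z - w| dμ(w)`; it is used only at points `z` away
from the support of a compactly supported `μ`, where the integral converges. -/
noncomputable def logPotential (μ : Measure ℂ) (z : ℂ) : ℝ := ∫ w, Real.log ‖z - w‖ ∂μ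

end HigherLame

namespace HigherLame

/-! Write `Q₂ = ∏ (X - ζ_l)`, `S = ∏ (X - s_i)`, `V = ∏ (X - v_i)` and `S^(k-1) = c ∏ (X - w_i)`.
The equation says that `V S` is, up to a nonzero constant, `∑ α_i ∏_{j ≠ i} (X - x_j)`, where `x`
consists of `w` and `ζ` together, with `α = 1` on `w` and `α = a` on `ζ`. With the weights
normalised to `β` of sum one, such a polynomial is the characteristic polynomial of the compression
of `diag x` to a hyperplane. In a Schur basis its zeros become averages of `x` by a matrix with row
sums `1` and column sums `1 - β_i` (`exists_averaging_fin`). The same fact for ordinary derivatives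
makes `w` an average of `s`. Thus `(v, s)` is averaged from `(s, ζ)`, and `Averages.cancel` removes
`s`: the zeros of `V` are averages of those of `Q₂`, with column sums at most one.

Jensen's inequality then gives `∑ f(v_i) ≤ ∑ f(ζ_l)` for nonnegative convex `f`. The two families
differ in size by the fixed number `k`, which is negligible after division by `p`; this yields the
Choquet order, and the moment inequalities with `f = |w|^m`. The averaging matrices themselves are
martingale couplings; a limit point of them, disintegrated over its first marginal, is the dilation.

The function `log |z - w|` is harmonic in `w` and in general not convex, so potentials need another
argument. For `z ∉ L` the numbers `1 / (z - x)` lie in a half-plane away from the origin, so a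
positive combination of them cannot cancel. Applied to each derivative and to the equation, this
gives `b^k |Q₂(z)| ≤ |V(z)|` with `b` independent of `p`, and the factor `b^k` is lost in the limit
of `p⁻¹ log`. -/

/-! ### Unitary compressions and Schur triangularization -/

open Polynomial Matrix in
/-- A unit vector is the first column of some unitary matrix. -/
theorem exists_unitary_first_column {m : ℕ} (v : Fin (m + 1) → ℂ) (hv : ∑ i, ‖v i‖ ^ 2 = 1) :
    ∃ U : Matrix (Fin (m + 1)) (Fin (m + 1)) ℂ,
      Uᴴ * U = 1 ∧ U * Uᴴ = 1 ∧ ∀ i, U i 0 = v i := by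
  let x : EuclideanSpace ℂ (Fin (m + 1)) := WithLp.toLp 2 v
  have hx : ‖x‖ = 1 := by
    rw [EuclideanSpace.norm_eq, Real.sqrt_eq_one]
    exact hv
  have ho : Orthonormal ℂ (({0} : Set (Fin (m + 1))).domRestrict fun _ => x) := by
    refine ⟨fun _ => hx, fun i j hij => (hij ?_).elim⟩
    exact Subsingleton.elim _ _
  obtain ⟨b, hb⟩ := ho.exists_orthonormalBasis_extension_of_card_eq (by simp)
  let U : Matrix (Fin (m + 1)) (Fin (m + 1)) ℂ := Matrix.of fun i j => b j i
  have hU : Uᴴ * U = 1 := by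
    ext i j
    have h := orthonormal_iff_ite.1 b.orthonormal i j
    rw [EuclideanSpace.inner_eq_star_dotProduct] at h
    rw [Matrix.mul_apply, Matrix.one_apply, ← h]
    simp [dotProduct, U, mul_comm]
  refine ⟨U, hU, mul_eq_one_comm.1 hU, fun i => ?_⟩
  simp [U, hb 0 rfl, x]

open Polynomial Matrix in
/-- The characteristic matrix transforms well under unitary conjugation. -/
theorem charmatrix_conj {n : Type*} [Fintype n] [DecidableEq n] (U B : Matrix n n ℂ)
    (hU : Uᴴ * U = 1) :
    (Uᴴ * B * U).charmatrix = Uᴴ.map C * B.charmatrix * U.map C := by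
  have h1 : Uᴴ.map (C : ℂ →+* ℂ[X]) * U.map C = 1 := by
    rw [← Matrix.map_mul, hU]
    simp
  simp only [Matrix.charmatrix, Matrix.mul_sub, Matrix.sub_mul, RingHom.mapMatrix_apply,
    Matrix.map_mul]
  congr 1
  rw [← (Matrix.scalar_commute (X : ℂ[X]) (fun _ => Commute.all _ _) (Uᴴ.map C)).eq,
    Matrix.mul_assoc, h1, Matrix.mul_one]

open Polynomial Matrix in
theorem charmatrix_submatrix_succ {m : ℕ} (B : Matrix (Fin (m + 1)) (Fin (m + 1)) ℂ) :
    B.charmatrix.submatrix Fin.succ Fin.succ = (B.submatrix Fin.succ Fin.succ).charmatrix := by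
  ext i j : 2
  by_cases h : i = j
  · subst h; simp [Matrix.charmatrix_apply_eq]
  · simp [Matrix.charmatrix_apply_ne _ _ _ h,
      Matrix.charmatrix_apply_ne _ _ _ (fun h' => h (Fin.succ_injective _ h'))]

open Polynomial Matrix in
/-- Schur triangularization, diagonal part: for any ordering of the eigenvalues of `B` there is an
orthonormal basis in which `B` has them as diagonal entries. -/
theorem exists_unitary_diag_eq : ∀ {m : ℕ} (B : Matrix (Fin m) (Fin m) ℂ) (y : Fin m → ℂ),
    B.charpoly = ∏ j, (X - C (y j)) →
    ∃ E : Matrix (Fin m) (Fin m) ℂ, Eᴴ * E = 1 ∧ ∀ j, (Eᴴ * B * E) j j = y j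
  | 0, _, _, _ => ⟨1, by simp, fun j => j.elim0⟩
  | m + 1, B, y, h => by
    have hdet : (Matrix.scalar (Fin (m + 1)) (y 0) - B).det = 0 := by
      rw [← Matrix.eval_charpoly, h, Polynomial.eval_prod]
      exact Finset.prod_eq_zero (Finset.mem_univ 0) (by simp)
    obtain ⟨u, hu0, hu⟩ := Matrix.exists_mulVec_eq_zero_iff.2 hdet
    have hpos : 0 < ∑ i, ‖u i‖ ^ 2 := by
      obtain ⟨i, hi⟩ := Function.ne_iff.1 hu0
      exact Finset.sum_pos' (fun _ _ => by positivity)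
        ⟨i, Finset.mem_univ i, pow_pos (norm_pos_iff.2 hi) 2⟩
    set r := Real.sqrt (∑ i, ‖u i‖ ^ 2) with hr
    have hr0 : 0 < r := Real.sqrt_pos.2 hpos
    let v : Fin (m + 1) → ℂ := ((r : ℂ)⁻¹) • u
    have hv : ∑ i, ‖v i‖ ^ 2 = 1 := by
      have : ∀ i, ‖v i‖ ^ 2 = (r ^ 2)⁻¹ * ‖u i‖ ^ 2 := fun i => by
        simp [v, mul_pow, abs_of_pos hr0]
      simp_rw [this]
      rw [← Finset.mul_sum, hr, Real.sq_sqrt hpos.le, inv_mul_cancel₀ hpos.ne']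
    have hBv : B *ᵥ v = y 0 • v := by
      have : B *ᵥ u = y 0 • u := by
        rw [Matrix.sub_mulVec, sub_eq_zero] at hu
        rw [← hu, Matrix.scalar_apply, ← Matrix.smul_one_eq_diagonal, Matrix.smul_mulVec,
          Matrix.one_mulVec]
      simp only [v]
      rw [Matrix.mulVec_smul, this, smul_comm]
    obtain ⟨U, hU, -, hUv⟩ := exists_unitary_first_column v hv
    have hUcol : U.col 0 = v := funext hUv
    -- Deflation: the first basis vector is an eigenvector for `y 0`, so the first column of `M`
    -- vanishes below the diagonal and the lower block `N` carries the remaining eigenvalues in the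
    -- given order.
    set M := Uᴴ * B * U with hM
    have hMcol : ∀ i, M i 0 = if i = 0 then y 0 else 0 := by
      intro i
      have h1 : M.col 0 = Uᴴ *ᵥ (B *ᵥ U.col 0) := by
        ext j
        rw [hM, Matrix.mulVec_mulVec]
        rfl
      have h2 : M.col 0 = y 0 • (Uᴴ * U).col 0 := by
        rw [h1, hUcol, hBv, Matrix.mulVec_smul, ← hUcol]
        rfl
      have h3 := congrFun h2 i
      rw [hU] at h3
      simpa [Matrix.one_apply] using h3
    set N := M.submatrix Fin.succ Fin.succ with hN
    have hcp : M.charpoly = B.charpoly := by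
      have h2 : (Uᴴ.map (C : ℂ →+* ℂ[X])).det * (U.map C).det = 1 := by
        rw [← Matrix.det_mul, ← Matrix.map_mul, hU]
        simp
      rw [Matrix.charpoly, hM, charmatrix_conj U B hU, Matrix.det_mul, Matrix.det_mul,
        Matrix.charpoly, mul_right_comm, h2, one_mul]
    have hMN : M.charpoly = (X - C (y 0)) * N.charpoly := by
      rw [Matrix.charpoly, Matrix.det_succ_column_zero, Fin.sum_univ_succ]
      have hz : ∀ i : Fin m, M.charmatrix i.succ 0 = 0 := fun i => by
        rw [Matrix.charmatrix_apply_ne _ _ _ (Fin.succ_ne_zero i), hMcol]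
        simp
      have h0 : M.charmatrix 0 0 = X - C (y 0) := by
        rw [Matrix.charmatrix_apply_eq, hMcol]
        simp
      simp only [hz, h0, mul_zero, zero_mul, Finset.sum_const_zero, add_zero, Fin.val_zero,
        pow_zero, one_mul]
      rw [Matrix.charpoly, hN, ← charmatrix_submatrix_succ]
      rfl
    have hNcp : N.charpoly = ∏ j : Fin m, (X - C (y j.succ)) := by
      have := hMN.symm.trans (hcp.trans h)
      rw [Fin.prod_univ_succ] at this
      exact mul_left_cancel₀ (X_sub_C_ne_zero _) this
    obtain ⟨E, hE, hEd⟩ := exists_unitary_diag_eq N (fun j => y j.succ) hNcp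
    let F : Matrix (Fin (m + 1)) (Fin (m + 1)) ℂ :=
      Matrix.of (Fin.cons (Fin.cons 1 0) fun i => Fin.cons 0 (E i))
    have F00 : F 0 0 = 1 := rfl
    have F0s : ∀ j : Fin m, F 0 j.succ = 0 := fun _ => rfl
    have Fs0 : ∀ i : Fin m, F i.succ 0 = 0 := fun _ => rfl
    have Fss : ∀ i j : Fin m, F i.succ j.succ = E i j := fun _ _ => rfl
    have hF : Fᴴ * F = 1 := by
      ext i j
      rw [Matrix.mul_apply, Fin.sum_univ_succ]
      simp only [Matrix.conjTranspose_apply]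
      refine Fin.cases ?_ (fun i => ?_) i <;> refine Fin.cases ?_ (fun j => ?_) j
      · simp [F00, Fs0]
      · simp [F0s, Fs0, (Fin.succ_ne_zero j).symm]
      · simp [F0s, Fs0]
      · have := congrFun (congrFun hE i) j
        simp only [Matrix.mul_apply, Matrix.conjTranspose_apply, Matrix.one_apply] at this
        simpa [F0s, Fss, Matrix.one_apply] using this
    refine ⟨U * F, ?_, fun j => ?_⟩
    · rw [Matrix.conjTranspose_mul, Matrix.mul_assoc, ← Matrix.mul_assoc Uᴴ, hU, Matrix.one_mul, hF]
    · have hconj : (U * F)ᴴ * B * (U * F) = Fᴴ * M * F := by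
        simp only [Matrix.conjTranspose_mul, hM, Matrix.mul_assoc]
      rw [hconj]
      refine Fin.cases ?_ (fun j => ?_) j
      · simp [Matrix.mul_apply, Fin.sum_univ_succ, F00, Fs0, hMcol]
      · rw [← hEd j]
        simp [Matrix.mul_apply, Fin.sum_univ_succ, F0s, Fss, hN]

open Polynomial Matrix in
/-- The monic polynomial `∑ β_i ∏_{j ≠ i} (X - x_j)` as a compression of a diagonal matrix: its
zeros `y` are averages of the `x`, by a matrix whose column sums are `1 - β`. -/
theorem exists_averaging_fin {m : ℕ} (x : Fin (m + 1) → ℂ) (β : Fin (m + 1) → ℝ)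
    (hβ : ∀ i, 0 ≤ β i) (hβ1 : ∑ i, β i = 1) :
    (∑ i, C (β i : ℂ) * ∏ j ∈ Finset.univ.erase i, (X - C (x j))).Monic ∧
    (∑ i, C (β i : ℂ) * ∏ j ∈ Finset.univ.erase i, (X - C (x j))).natDegree = m ∧
    ∀ y : Fin m → ℂ,
      ∏ j, (X - C (y j)) = ∑ i, C (β i : ℂ) * ∏ j ∈ Finset.univ.erase i, (X - C (x j)) →
      ∃ A : Fin m → Fin (m + 1) → ℝ, (∀ j i, 0 ≤ A j i) ∧ (∀ j, ∑ i, A j i = 1) ∧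
        (∀ i, ∑ j, A j i = 1 - β i) ∧ ∀ j, y j = ∑ i, (A j i : ℂ) * x i := by
  -- The weights become squared moduli of a unit vector `v`, and `N` is the compression of `diag x`
  -- to the orthogonal complement of `v`. Its characteristic polynomial is the `(0, 0)` entry of the
  -- adjugate of the conjugated characteristic matrix. The adjugate is conjugated in the same way,
  -- so this entry is `∑ |v_i|² ∏_{j ≠ i} (X - x_j)`.
  let v : Fin (m + 1) → ℂ := fun i => (Real.sqrt (β i) : ℂ)
  have hvβ : ∀ i, ‖v i‖ ^ 2 = β i := fun i => by
    simp [v, abs_of_nonneg (Real.sqrt_nonneg _), Real.sq_sqrt (hβ i)]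
  obtain ⟨U, hU, hU', hUv⟩ := exists_unitary_first_column v (by simp_rw [hvβ]; exact hβ1)
  set N := (Uᴴ * Matrix.diagonal x * U).submatrix Fin.succ Fin.succ with hN
  have hcp : N.charpoly =
      ∑ i, C (β i : ℂ) * ∏ j ∈ Finset.univ.erase i, (X - C (x j)) := by
    have h0 : N.charpoly = (Uᴴ * Matrix.diagonal x * U).charmatrix.adjugate 0 0 := by
      rw [Matrix.adjugate_fin_succ_eq_det_submatrix, Matrix.charpoly, hN,
        ← charmatrix_submatrix_succ]
      simp only [Fin.val_zero, add_zero, pow_zero, one_mul]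
      rfl
    have h1 : Uᴴ.map (C : ℂ →+* ℂ[X]) * U.map C = 1 := by
      rw [← Matrix.map_mul, hU]
      simp
    have hdet : (Uᴴ.map (C : ℂ →+* ℂ[X])).det * (U.map C).det = 1 := by
      rw [← Matrix.det_mul, h1, Matrix.det_one]
    have hadj1 : (U.map (C : ℂ →+* ℂ[X])).adjugate = (U.map C).det • Uᴴ.map C := by
      have := congrArg (fun Z => Uᴴ.map (C : ℂ →+* ℂ[X]) * Z) (Matrix.mul_adjugate (U.map C))
      simp only [← Matrix.mul_assoc, h1, Matrix.one_mul] at this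
      rw [this]
      simp
    have hadj2 : (Uᴴ.map (C : ℂ →+* ℂ[X])).adjugate = (Uᴴ.map C).det • U.map C := by
      have := congrArg (fun Z => Z * U.map (C : ℂ →+* ℂ[X])) (Matrix.adjugate_mul (Uᴴ.map C))
      simp only [Matrix.mul_assoc, h1, Matrix.mul_one] at this
      rw [this]
      simp
    have hcd : (Matrix.diagonal x).charmatrix = Matrix.diagonal fun i => X - C (x i) := by
      ext i j : 2
      by_cases h : i = j
      · subst h; simp [Matrix.charmatrix_apply_eq]
      · simp [Matrix.charmatrix_apply_ne _ _ _ h, Matrix.diagonal_apply_ne _ h]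
    rw [h0, charmatrix_conj U _ hU, Matrix.adjugate_mul_distrib, Matrix.adjugate_mul_distrib,
      hadj1, hadj2, hcd, Matrix.adjugate_diagonal]
    simp only [Matrix.smul_mul, Matrix.mul_smul, smul_smul]
    rw [hdet, one_smul, ← Matrix.mul_assoc]
    rw [Matrix.mul_apply]
    refine Finset.sum_congr rfl fun i _ => ?_
    rw [Matrix.mul_diagonal, Matrix.map_apply, Matrix.map_apply, Matrix.conjTranspose_apply, hUv,
      mul_right_comm, ← C_mul]
    congr 2
    rw [← hvβ, ← Complex.normSq_eq_norm_sq, Complex.normSq_eq_conj_mul_self]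
    rfl
  refine ⟨hcp ▸ N.charpoly_monic, hcp ▸ by simp [Matrix.charpoly_natDegree_eq_dim], fun y hy => ?_⟩
  obtain ⟨E, hE, hEd⟩ := exists_unitary_diag_eq N y (hcp.trans hy.symm)
  have hE' : E * Eᴴ = 1 := mul_eq_one_comm.1 hE
  let W : Matrix (Fin (m + 1)) (Fin m) ℂ := U.submatrix id Fin.succ
  -- The columns of `G` are an orthonormal basis of the complement of `v` in which the compression
  -- has diagonal `y`. The averaging weights are `|G i j|²`: `Gᴴ G = 1` gives the row sums, and `G
  -- Gᴴ = 1 - v vᴴ` the column sums `1 - β i`.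
  let G : Matrix (Fin (m + 1)) (Fin m) ℂ := W * E
  have hWW : Wᴴ * W = 1 := by
    ext i j
    have := congrFun (congrFun hU i.succ) j.succ
    simpa [Matrix.mul_apply, Matrix.one_apply, W] using this
  have hGG : Gᴴ * G = 1 := by
    simp only [G]
    rw [Matrix.conjTranspose_mul, Matrix.mul_assoc, ← Matrix.mul_assoc Wᴴ, hWW, Matrix.one_mul, hE]
  have hGG' : G * Gᴴ = W * Wᴴ := by
    simp only [G]
    rw [Matrix.conjTranspose_mul, Matrix.mul_assoc, ← Matrix.mul_assoc E, hE', Matrix.one_mul]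
  have hGD : Gᴴ * Matrix.diagonal x * G = Eᴴ * N * E := by
    have : N = Wᴴ * Matrix.diagonal x * W := by
      ext i j
      simp [hN, W, Matrix.mul_apply]
    rw [this]
    simp only [G, Matrix.conjTranspose_mul, Matrix.mul_assoc]
  have hn : ∀ z : ℂ, ((‖z‖ ^ 2 : ℝ) : ℂ) = star z * z := fun z => by
    rw [← Complex.normSq_eq_norm_sq, Complex.normSq_eq_conj_mul_self]
    rfl
  refine ⟨fun j i => ‖G i j‖ ^ 2, fun _ _ => by positivity, fun j => ?_, fun i => ?_, fun j => ?_⟩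
  · have := congrFun (congrFun hGG j) j
    rw [Matrix.mul_apply] at this
    apply Complex.ofReal_injective
    rw [Complex.ofReal_sum]
    simp_rw [hn]
    simpa using this
  · have h1 := congrFun (congrFun hGG' i) i
    have h2 := congrFun (congrFun hU' i) i
    rw [Matrix.mul_apply, Fin.sum_univ_succ] at h2
    rw [Matrix.mul_apply, Matrix.mul_apply] at h1
    apply Complex.ofReal_injective
    rw [Complex.ofReal_sum, Complex.ofReal_sub, ← hvβ, ← hUv]
    simp_rw [hn]
    simp only [Matrix.conjTranspose_apply, Matrix.one_apply, if_true] at h1 h2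
    simp only [mul_comm (star _)]
    rw [h1, Complex.ofReal_one, ← h2, add_sub_cancel_left]
    rfl
  · rw [← hEd j, ← hGD, Matrix.mul_apply]
    refine Finset.sum_congr rfl fun i _ => ?_
    rw [Matrix.mul_diagonal, hn, Matrix.conjTranspose_apply]
    ring

/-! ### Families averaged from other families -/

/-- The points `x i` are averages of the points `y j`, through a matrix with nonnegative entries
whose row sums are one and whose column sums are at most one. -/
def Averages {ι κ : Type*} [Fintype ι] [Fintype κ] (x : ι → ℂ) (y : κ → ℂ) : Prop :=
  ∃ A : ι → κ → ℝ, (∀ i j, 0 ≤ A i j) ∧ (∀ i, ∑ j, A i j = 1) ∧ (∀ j, ∑ i, A i j ≤ 1) ∧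
    ∀ i, x i = ∑ j, (A i j : ℂ) * y j

namespace Averages

variable {ι κ σ : Type*} [Fintype ι] [Fintype κ] [Fintype σ]

theorem refl (x : ι → ℂ) : Averages x x := by
  classical
  exact ⟨fun i j => if i = j then 1 else 0, fun i j => by positivity, fun i => by simp,
    fun j => by simp, fun i => by simp [apply_ite Complex.ofReal]⟩

theorem trans {x : ι → ℂ} {y : κ → ℂ} {z : σ → ℂ} (h₁ : Averages x y) (h₂ : Averages y z) :
    Averages x z := by
  obtain ⟨A, hA, hA1, hA2, hA3⟩ := h₁
  obtain ⟨B, hB, hB1, hB2, hB3⟩ := h₂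
  refine ⟨fun i l => ∑ j, A i j * B j l,
    fun i l => Finset.sum_nonneg fun j _ => mul_nonneg (hA i j) (hB j l), fun i => ?_,
    fun l => ?_, fun i => ?_⟩
  · rw [Finset.sum_comm]
    simp_rw [← Finset.mul_sum, hB1, mul_one, hA1]
  · rw [Finset.sum_comm]
    simp_rw [← Finset.sum_mul]
    exact (Finset.sum_le_sum fun j _ => mul_le_of_le_one_left (hB j l) (hA2 j)).trans (hB2 l)
  · rw [hA3]
    simp_rw [hB3, Finset.mul_sum]
    rw [Finset.sum_comm]
    refine Finset.sum_congr rfl fun l _ => ?_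
    push_cast
    rw [Finset.sum_mul]
    exact Finset.sum_congr rfl fun j _ => by ring

theorem sum_elim {x : ι → ℂ} {y : κ → ℂ} (h : Averages x y) (z : σ → ℂ) :
    Averages (Sum.elim x z) (Sum.elim y z) := by
  classical
  obtain ⟨A, hA, hA1, hA2, hA3⟩ := h
  refine ⟨Sum.elim (fun i => Sum.elim (A i) 0)
    (fun k => Sum.elim 0 fun l => if k = l then 1 else 0), ?_, ?_, ?_, ?_⟩
  · rintro (i | k) (j | l)
    · exact hA i j
    · exact le_rfl
    · exact le_rfl
    · simp only [Sum.elim_inr]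
      positivity
  · rintro (i | k) <;> simp [hA1]
  · rintro (j | l) <;> simp [hA2]
  · rintro (i | k) <;> simp [hA3, apply_ite Complex.ofReal]

theorem mem {x : ι → ℂ} {y : κ → ℂ} (h : Averages x y) {L : Set ℂ} (hL : Convex ℝ L)
    (hy : ∀ j, y j ∈ L) (i : ι) : x i ∈ L := by
  obtain ⟨A, hA, hA1, -, hA3⟩ := h
  rw [hA3]
  simp_rw [← Complex.real_smul]
  exact hL.sum_mem (fun j _ => hA i j) (hA1 i) fun j _ => hy j

/-- Jensen along the rows, followed by the bound on the column sums; only the latter needs `f ≥ 0`.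
-/
theorem sum_le {x : ι → ℂ} {y : κ → ℂ} (h : Averages x y) {L : Set ℂ} {f : ℂ → ℝ}
    (hf : ConvexOn ℝ L f) (hf0 : ∀ z ∈ L, 0 ≤ f z) (hy : ∀ j, y j ∈ L) :
    ∑ i, f (x i) ≤ ∑ j, f (y j) := by
  obtain ⟨A, hA, hA1, hA2, hA3⟩ := h
  calc ∑ i, f (x i) ≤ ∑ i, ∑ j, A i j * f (y j) := by
        refine Finset.sum_le_sum fun i _ => ?_
        rw [hA3]
        simp_rw [← Complex.real_smul]
        exact hf.map_sum_le (fun j _ => hA i j) (hA1 i) fun j _ => hy j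
    _ = ∑ j, (∑ i, A i j) * f (y j) := by
        rw [Finset.sum_comm]
        simp_rw [Finset.sum_mul]
    _ ≤ ∑ j, f (y j) :=
        Finset.sum_le_sum fun j _ => mul_le_of_le_one_left (hf0 _ (hy j)) (hA2 j)

/-- A family common to both sides can be cancelled. -/
theorem cancel {v : ι → ℂ} {s : σ → ℂ} {z : κ → ℂ}
    (h : Averages (Sum.elim v s) (Sum.elim s z)) : Averages v z := by
  obtain ⟨A, hA, hA1, hA2, hA3⟩ := h
  let Y : ι → σ → ℝ := fun i k => A (Sum.inl i) (Sum.inl k)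
  let Z : ι → κ → ℝ := fun i l => A (Sum.inl i) (Sum.inr l)
  let N : σ → σ → ℝ := fun k k' => A (Sum.inr k) (Sum.inl k')
  let R : σ → κ → ℝ := fun k l => A (Sum.inr k) (Sum.inr l)
  -- Repeated substitution of `s = N s + R z` into `v = Y s + Z z`. The iterates `T` increase and
  -- have column sums at most one, so they converge to a solution of `X = Y + X N`, and `Z + X R` is
  -- the wanted matrix. Invertibility of `1 - N` is not needed.
  let T : ℕ → ι → σ → ℝ := fun n =>
    Nat.rec (fun _ _ => 0) (fun _ T i k => Y i k + ∑ k', T i k' * N k' k) n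
  have T0 : ∀ i k, T 0 i k = 0 := fun _ _ => rfl
  have Ts : ∀ n i k, T (n + 1) i k = Y i k + ∑ k', T n i k' * N k' k := fun _ _ _ => rfl
  have hY : ∀ i k, 0 ≤ Y i k := fun _ _ => hA _ _
  have hZ : ∀ i k, 0 ≤ Z i k := fun _ _ => hA _ _
  have hN : ∀ i k, 0 ≤ N i k := fun _ _ => hA _ _
  have hR : ∀ i k, 0 ≤ R i k := fun _ _ => hA _ _
  have rowv : ∀ i, ∑ k, Y i k + ∑ l, Z i l = 1 := fun i => by
    rw [← hA1 (Sum.inl i), Fintype.sum_sum_type]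
  have rows : ∀ i, ∑ k, N i k + ∑ l, R i l = 1 := fun i => by
    rw [← hA1 (Sum.inr i), Fintype.sum_sum_type]
  have cols : ∀ k, ∑ i, Y i k + ∑ k', N k' k ≤ 1 := fun k => by
    have := hA2 (Sum.inl k)
    rwa [Fintype.sum_sum_type] at this
  have colz : ∀ l, ∑ i, Z i l + ∑ k', R k' l ≤ 1 := fun l => by
    have := hA2 (Sum.inr l)
    rwa [Fintype.sum_sum_type] at this
  have eqv : ∀ i, v i = ∑ k, (Y i k : ℂ) * s k + ∑ l, (Z i l : ℂ) * z l := fun i => by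
    have := hA3 (Sum.inl i)
    rwa [Fintype.sum_sum_type] at this
  have eqs : ∀ k, s k = ∑ k', (N k k' : ℂ) * s k' + ∑ l, (R k l : ℂ) * z l := fun k => by
    have := hA3 (Sum.inr k)
    rwa [Fintype.sum_sum_type] at this
  have Tnn : ∀ n i k, 0 ≤ T n i k := by
    intro n
    induction n with
    | zero => exact fun i k => (T0 i k).ge
    | succ n ih =>
      intro i k
      rw [Ts]
      exact add_nonneg (hY i k) (Finset.sum_nonneg fun k' _ => mul_nonneg (ih i k') (hN k' k))
  have Tmono : ∀ i k, Monotone fun n => T n i k := by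
    suffices ∀ n i k, T n i k ≤ T (n + 1) i k from
      fun i k => monotone_nat_of_le_succ fun n => this n i k
    intro n
    induction n with
    | zero => exact fun i k => (T0 i k).trans_le (Tnn 1 i k)
    | succ n ih =>
      intro i k
      rw [Ts, Ts (n + 1)]
      gcongr with k'
      · exact hN k' k
      · exact ih i k'
  have Tcol : ∀ n k, ∑ i, T n i k ≤ 1 := by
    intro n
    induction n with
    | zero => simp [T0]
    | succ n ih =>
      intro k
      simp_rw [Ts]
      rw [Finset.sum_add_distrib, Finset.sum_comm]
      simp_rw [← Finset.sum_mul]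
      exact (add_le_add le_rfl (Finset.sum_le_sum fun k' _ =>
        mul_le_of_le_one_left (hN k' k) (ih k'))).trans (cols k)
  have Tle : ∀ n i k, T n i k ≤ 1 := fun n i k =>
    (Finset.single_le_sum (f := fun i => T n i k) (fun i _ => Tnn n i k)
      (Finset.mem_univ i)).trans (Tcol n k)
  have hlim : ∀ i k, ∃ x, Tendsto (fun n => T n i k) atTop (𝓝 x) := fun i k =>
    ⟨_, tendsto_atTop_ciSup (Tmono i k) ⟨1, Set.forall_mem_range.2 fun n => Tle n i k⟩⟩
  choose X hX using hlim
  have Xnn : ∀ i k, 0 ≤ X i k := fun i k => ge_of_tendsto' (hX i k) fun n => Tnn n i k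
  have Xcol : ∀ k, ∑ i, X i k ≤ 1 := fun k =>
    le_of_tendsto' (tendsto_finsetSum _ fun i _ => hX i k) fun n => Tcol n k
  have Xeq : ∀ i k, X i k = Y i k + ∑ k', X i k' * N k' k := fun i k =>
    tendsto_nhds_unique ((tendsto_add_atTop_iff_nat 1).2 (hX i k))
      (tendsto_const_nhds.add (tendsto_finsetSum _ fun k' _ => (hX i k').mul_const _))
  refine ⟨fun i l => Z i l + ∑ k, X i k * R k l, fun i l => add_nonneg (hZ i l)
    (Finset.sum_nonneg fun k _ => mul_nonneg (Xnn i k) (hR k l)), fun i => ?_, fun l => ?_,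
    fun i => ?_⟩
  -- Two expressions for the row sum of `X`, from `X = Y + X N` and from the unit row sums of `(N,
  -- R)`; their comparison turns the mass of `Y` into that of `X R`. The identity for `v i` below is
  -- obtained likewise.
  · have h1 : ∑ k, X i k = ∑ k, Y i k + ∑ k', X i k' * ∑ k, N k' k := by
      simp_rw [Finset.mul_sum]
      rw [Finset.sum_comm (s := Finset.univ (α := σ)), ← Finset.sum_add_distrib]
      exact Finset.sum_congr rfl fun k _ => Xeq i k
    have h2 : ∑ k, X i k = ∑ k, X i k * ∑ k', N k k' + ∑ k, X i k * ∑ l, R k l := by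
      rw [← Finset.sum_add_distrib]
      simp_rw [← mul_add, rows, mul_one]
    rw [Finset.sum_add_distrib, Finset.sum_comm]
    simp_rw [← Finset.mul_sum]
    linarith [rowv i]
  · rw [Finset.sum_add_distrib, Finset.sum_comm]
    simp_rw [← Finset.sum_mul]
    exact (add_le_add le_rfl (Finset.sum_le_sum fun k _ =>
      mul_le_of_le_one_left (hR k l) (Xcol k))).trans (colz l)
  · have h1 : ∑ k, (X i k : ℂ) * s k =
        ∑ k, (Y i k : ℂ) * s k + ∑ k', (X i k' : ℂ) * ∑ k, (N k' k : ℂ) * s k := by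
      simp_rw [Finset.mul_sum]
      rw [Finset.sum_comm (s := Finset.univ (α := σ)), ← Finset.sum_add_distrib]
      refine Finset.sum_congr rfl fun k _ => ?_
      rw [Xeq i k]
      push_cast
      rw [add_mul, Finset.sum_mul]
      simp_rw [mul_assoc]
    have h2 : ∑ k, (X i k : ℂ) * s k =
        ∑ k, (X i k : ℂ) * (∑ k', (N k k' : ℂ) * s k') +
          ∑ k, (X i k : ℂ) * ∑ l, (R k l : ℂ) * z l := by
      rw [← Finset.sum_add_distrib]
      exact Finset.sum_congr rfl fun k _ => by rw [← mul_add, ← eqs k]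
    have h3 : ∑ l, ((Z i l + ∑ k, X i k * R k l : ℝ) : ℂ) * z l =
        ∑ l, (Z i l : ℂ) * z l + ∑ k, (X i k : ℂ) * ∑ l, (R k l : ℂ) * z l := by
      simp_rw [Finset.mul_sum]
      rw [Finset.sum_comm (s := Finset.univ (α := σ)), ← Finset.sum_add_distrib]
      refine Finset.sum_congr rfl fun l _ => ?_
      push_cast
      rw [add_mul, Finset.sum_mul]
      simp_rw [mul_assoc]
    rw [h3, eqv i]
    linear_combination h2 - h1

end Averages

/-! ### Weighted derivatives of a product of linear factors -/

open Polynomial in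
/-- A monic polynomial over `ℂ` as a product of linear factors, indexed by any type of the right
cardinality. -/
theorem exists_eq_prod_X_sub_C {κ : Type*} [Fintype κ] {P : ℂ[X]} (hP : P.Monic)
    (hd : P.natDegree = Fintype.card κ) : ∃ s : κ → ℂ, P = ∏ i, (X - C (s i)) := by
  have hs : P.Splits := IsAlgClosed.splits P
  have hcard : P.roots.toList.length = Fintype.card κ := by
    rw [Multiset.length_toList, ← hs.natDegree_eq_card_roots, hd]
  let e : κ ≃ Fin P.roots.toList.length :=
    (Fintype.equivFin κ).trans (finCongr hcard.symm)
  refine ⟨fun i => P.roots.toList.get (e i), ?_⟩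
  rw [e.prod_comp (fun i => X - C (P.roots.toList.get i)), ← List.prod_ofFn]
  conv_lhs => rw [hs.eq_prod_roots_of_monic hP, ← Multiset.coe_toList P.roots,
    Multiset.map_coe, Multiset.prod_coe]
  congr 1
  apply List.ext_get <;> simp

section WeightedDerivative

variable {ι κ : Type*} [Fintype ι] [DecidableEq ι] [Fintype κ]

open Polynomial in
/-- The polynomial `∑ α_i ∏_{j ≠ i} (X - x_j)`. -/
noncomputable def weightedDerivative (x : ι → ℂ) (α : ι → ℝ) : ℂ[X] :=
  ∑ i, C (α i : ℂ) * ∏ j ∈ Finset.univ.erase i, (X - C (x j))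

open Polynomial in
theorem weightedDerivative_one (x : ι → ℂ) :
    weightedDerivative x 1 = derivative (∏ i, (X - C (x i))) := by
  simp [weightedDerivative, Polynomial.derivative_prod_finset]

open Polynomial in
theorem weightedDerivative_smul (x : ι → ℂ) (α : ι → ℝ) (t : ℝ) :
    weightedDerivative x (t • α) = C (t : ℂ) * weightedDerivative x α := by
  simp [weightedDerivative, Finset.mul_sum, mul_assoc]

-- The `Fin` version transported to arbitrary index types, since disjoint unions of families occur
-- on both sides.
open Polynomial in
theorem exists_averaging_of_sum_eq_one (hcard : Fintype.card ι = Fintype.card κ + 1) (x : ι → ℂ)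
    (β : ι → ℝ) (hβ : ∀ i, 0 ≤ β i) (hβ1 : ∑ i, β i = 1) :
    (weightedDerivative x β).Monic ∧ (weightedDerivative x β).natDegree = Fintype.card κ ∧
    ∀ y : κ → ℂ, ∏ j, (X - C (y j)) = weightedDerivative x β →
      ∃ A : κ → ι → ℝ, (∀ j i, 0 ≤ A j i) ∧ (∀ j, ∑ i, A j i = 1) ∧
        (∀ i, ∑ j, A j i = 1 - β i) ∧ ∀ j, y j = ∑ i, (A j i : ℂ) * x i := by
  let e : ι ≃ Fin (Fintype.card κ + 1) := (Fintype.equivFin ι).trans (finCongr hcard)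
  let g : κ ≃ Fin (Fintype.card κ) := Fintype.equivFin κ
  have hwd : weightedDerivative x β = ∑ i, C ((β (e.symm i) : ℝ) : ℂ) *
      ∏ j ∈ Finset.univ.erase i, (X - C (x (e.symm j))) := by
    rw [weightedDerivative, ← e.symm.sum_comp]
    refine Finset.sum_congr rfl fun i _ => ?_
    congr 1
    refine Finset.prod_bij (fun j _ => e j) ?_ ?_ ?_ ?_
    · intro j hj
      simp only [Finset.mem_erase, Finset.mem_univ, and_true] at hj ⊢
      exact fun h => hj (by rw [← h, Equiv.symm_apply_apply])
    · exact fun _ _ _ _ h => e.injective h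
    · intro j hj
      simp only [Finset.mem_erase, Finset.mem_univ, and_true] at hj
      exact ⟨e.symm j, by simpa using hj, by simp⟩
    · simp
  obtain ⟨h1, h2, h3⟩ := exists_averaging_fin (fun i => x (e.symm i)) (fun i => β (e.symm i))
    (fun i => hβ _) (by rw [e.symm.sum_comp]; exact hβ1)
  rw [← hwd] at h1 h2 h3
  refine ⟨h1, h2, fun y hy => ?_⟩
  obtain ⟨A, hA, hA1, hA2, hA3⟩ := h3 (fun j => y (g.symm j))
    (by rw [g.symm.prod_comp fun j => X - C (y j)]; exact hy)
  refine ⟨fun j i => A (g j) (e i), fun _ _ => hA _ _, fun j => ?_, fun i => ?_, fun j => ?_⟩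
  · rw [e.sum_comp]
    exact hA1 _
  · rw [g.sum_comp fun j => A j (e i), hA2, Equiv.symm_apply_apply]
  · have := hA3 (g j)
    rw [Equiv.symm_apply_apply] at this
    rw [this, ← e.sum_comp]
    simp

open Polynomial in
/-- A weighted derivative with positive weights is a nonzero multiple of a monic polynomial, whose
zeros are averages of the given points. -/
theorem weightedDerivative_spec (hcard : Fintype.card ι = Fintype.card κ + 1) (x : ι → ℂ)
    (α : ι → ℝ) (hα : ∀ i, 0 < α i) {P : ℂ[X]} (hP : P.Monic) {c : ℂ}
    (h : weightedDerivative x α = C c * P) :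
    c = ((∑ i, α i : ℝ) : ℂ) ∧
    ∀ y : κ → ℂ, P = ∏ j, (X - C (y j)) →
      ∃ A : κ → ι → ℝ, (∀ j i, 0 ≤ A j i) ∧ (∀ j, ∑ i, A j i = 1) ∧
        (∀ i, ∑ j, A j i < 1) ∧ ∀ j, y j = ∑ i, (A j i : ℂ) * x i := by
  set t := ∑ i, α i with ht
  have hne : Nonempty ι := Fintype.card_pos_iff.1 (by omega)
  have ht0 : 0 < t := Finset.sum_pos (fun i _ => hα i) Finset.univ_nonempty
  have hβ1 : ∑ i, (t⁻¹ • α) i = 1 := by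
    simp only [Pi.smul_apply, smul_eq_mul]
    rw [← Finset.mul_sum, ← ht, inv_mul_cancel₀ ht0.ne']
  have hβ : ∀ i, 0 < (t⁻¹ • α) i := fun i => mul_pos (inv_pos.2 ht0) (hα i)
  obtain ⟨h1, -, h3⟩ := exists_averaging_of_sum_eq_one hcard x (t⁻¹ • α)
    (fun i => (hβ i).le) hβ1
  have hα' : α = t • t⁻¹ • α := by rw [smul_smul, mul_inv_cancel₀ ht0.ne', one_smul]
  rw [hα', weightedDerivative_smul] at h
  have hc : c = (t : ℂ) := by
    have := congrArg leadingCoeff h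
    rw [leadingCoeff_mul, leadingCoeff_mul, h1.leadingCoeff, hP.leadingCoeff, leadingCoeff_C,
      leadingCoeff_C, mul_one, mul_one] at this
    exact this.symm
  have hPeq : P = weightedDerivative x (t⁻¹ • α) := by
    rw [hc] at h
    refine (mul_left_cancel₀ ?_ h).symm
    rw [Ne, C_eq_zero]
    exact_mod_cast ht0.ne'
  refine ⟨hc, fun y hy => ?_⟩
  obtain ⟨A, hA, hA1, hA2, hA3⟩ := h3 y (hy.symm.trans hPeq)
  exact ⟨A, hA, hA1, fun i => by rw [hA2]; linarith [hβ i], hA3⟩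

-- Divided by `∏ (z - x_i)` the value is `∑ α_i / (z - x_i)`. After rotation by `a` every summand
-- has real part at least `c α_i`, so nothing cancels.
open Polynomial in
theorem norm_eval_weightedDerivative_ge (x : ι → ℂ) (α : ι → ℝ) (hα : ∀ i, 0 ≤ α i)
    {z a : ℂ} {c : ℝ} (ha : ‖a‖ = 1) (hx : ∀ i, z ≠ x i) (hc : ∀ i, c ≤ (a / (z - x i)).re) :
    c * (∑ i, α i) * ∏ i, ‖z - x i‖ ≤ ‖(weightedDerivative x α).eval z‖ := by
  have h1 : (weightedDerivative x α).eval z =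
      (∑ i, (α i : ℂ) / (z - x i)) * ∏ i, (z - x i) := by
    rw [weightedDerivative, eval_finsetSum, Finset.sum_mul]
    refine Finset.sum_congr rfl fun i _ => ?_
    rw [eval_mul, eval_C, eval_prod, ← Finset.mul_prod_erase _ _ (Finset.mem_univ i), ← mul_assoc,
      div_mul_cancel₀ _ (sub_ne_zero.2 (hx i))]
    simp
  rw [h1, norm_mul, norm_prod]
  gcongr
  calc c * ∑ i, α i ≤ ∑ i, α i * (a / (z - x i)).re := by
        rw [Finset.mul_sum]
        exact Finset.sum_le_sum fun i _ => by nlinarith [hα i, hc i]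
    _ = (a * ∑ i, (α i : ℂ) / (z - x i)).re := by
        rw [Finset.mul_sum, Complex.re_sum]
        refine Finset.sum_congr rfl fun i _ => ?_
        rw [← Complex.re_ofReal_mul]
        congr 1
        ring
    _ ≤ ‖a * ∑ i, (α i : ℂ) / (z - x i)‖ := Complex.re_le_norm _
    _ = _ := by rw [norm_mul, ha, one_mul]

end WeightedDerivative

open Polynomial in
/-- The zeros of the iterated derivatives of a polynomial. -/
theorem iterate_derivative_prod {n : ℕ} (s : Fin n → ℂ) (j : ℕ) (hj : j ≤ n) :
    ∃ (w : Fin (n - j) → ℂ) (c : ℂ), c ≠ 0 ∧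
      derivative^[j] (∏ i, (X - C (s i))) = C c * ∏ i, (X - C (w i)) ∧ Averages w s ∧
      ∀ (L : Set ℂ), Convex ℝ L → (∀ i, s i ∈ L) → ∀ z a : ℂ, z ∉ L → ∀ b : ℝ, 0 ≤ b → ‖a‖ = 1 →
        (∀ x ∈ L, b ≤ (a / (z - x)).re) →
        b ^ j * ∏ i, ‖z - s i‖ ≤ ∏ i, ‖z - w i‖ := by
  induction j with
  | zero => exact ⟨s, 1, one_ne_zero, by simp, .refl s, by simp⟩
  | succ j ih =>
    obtain ⟨w, c, hc, hw, hav, hb⟩ := ih (by omega)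
    have hcard : Fintype.card (Fin (n - j)) = Fintype.card (Fin (n - (j + 1))) + 1 := by
      simp only [Fintype.card_fin]
      omega
    have hwt : (∑ _i : Fin (n - j), (1 : Fin (n - j) → ℝ) _i) = ((n - j : ℕ) : ℝ) := by simp
    have hnj : ((n - j : ℕ) : ℝ) ≠ 0 := by
      have : n - j ≠ 0 := by omega
      exact_mod_cast this
    -- Normalising the unit weights makes the derivative monic; as the weights then sum to one, each
    -- differentiation costs exactly one factor `b` in the lower bound.
    obtain ⟨hm, hd, -⟩ := exists_averaging_of_sum_eq_one hcard w
      (((n - j : ℕ) : ℝ)⁻¹ • 1) (fun i => by simp) (by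
        simp only [Pi.smul_apply, smul_eq_mul]
        rw [← Finset.mul_sum, hwt, inv_mul_cancel₀ hnj])
    set P := weightedDerivative w (((n - j : ℕ) : ℝ)⁻¹ • 1) with hP
    have hwP : weightedDerivative w 1 = C (((n - j : ℕ) : ℝ) : ℂ) * P := by
      rw [hP, ← weightedDerivative_smul, smul_smul, mul_inv_cancel₀ hnj, one_smul]
    obtain ⟨y, hy⟩ := exists_eq_prod_X_sub_C hm hd
    obtain ⟨A, hA, hA1, hA2, hA3⟩ :=
      (weightedDerivative_spec hcard w 1 (fun _ => one_pos) hm hwP).2 y hy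
    have hyw : Averages y w := ⟨A, hA, hA1, fun i => (hA2 i).le, hA3⟩
    refine ⟨y, c * (((n - j : ℕ) : ℝ) : ℂ), mul_ne_zero hc (by exact_mod_cast hnj), ?_,
      hyw.trans hav, fun L hL hs z a hz b hb0 ha hLb => ?_⟩
    · rw [Function.iterate_succ_apply', hw, derivative_C_mul, ← weightedDerivative_one, hwP, C_mul,
        mul_assoc, ← hy]
    · have hwL := hav.mem hL hs
      have h1 := hb L hL hs z a hz b hb0 ha hLb
      have h2 := norm_eval_weightedDerivative_ge w (((n - j : ℕ) : ℝ)⁻¹ • 1)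
        (fun i => by simp) ha (fun i (h : z = w i) => hz (h ▸ hwL i)) (fun i => hLb _ (hwL i))
      rw [← hP, hy, eval_prod, norm_prod] at h2
      simp only [Pi.smul_apply, smul_eq_mul] at h2
      rw [← Finset.mul_sum, hwt, inv_mul_cancel₀ hnj, mul_one] at h2
      simp only [eval_sub, eval_X, eval_C] at h2
      calc b ^ (j + 1) * ∏ i, ‖z - s i‖ = b * (b ^ j * ∏ i, ‖z - s i‖) := by ring
        _ ≤ b * ∏ i, ‖z - w i‖ := by gcongr
        _ ≤ _ := h2

/-! ### The zeros of higher Van Vleck polynomials -/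

-- The product rule for weighted derivatives. With weights `1` on the first family it presents `P'
-- Q₂ + P Q₁` as a single weighted derivative.
open Polynomial in
theorem weightedDerivative_sum_elim {ι κ : Type*} [Fintype ι] [DecidableEq ι] [Fintype κ]
    [DecidableEq κ] (x : ι → ℂ) (y : κ → ℂ) (α : ι → ℝ) (β : κ → ℝ) :
    weightedDerivative (Sum.elim x y) (Sum.elim α β) =
      weightedDerivative x α * ∏ j, (X - C (y j)) +
        (∏ i, (X - C (x i))) * weightedDerivative y β := by
  have hl : ∀ i : ι, (Finset.univ.erase (Sum.inl i) : Finset (ι ⊕ κ)) =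
      (Finset.univ.erase i).disjSum Finset.univ := fun i => by
    ext (j | j) <;> simp
  have hr : ∀ i : κ, (Finset.univ.erase (Sum.inr i) : Finset (ι ⊕ κ)) =
      Finset.univ.disjSum (Finset.univ.erase i) := fun i => by
    ext (j | j) <;> simp
  simp only [weightedDerivative, Fintype.sum_sum_type, Sum.elim_inl, Sum.elim_inr, hl, hr,
    Finset.prod_disjSum, Finset.sum_mul, Finset.mul_sum]
  exact congrArg₂ (· + ·) (Finset.sum_congr rfl fun i _ => by rw [mul_assoc])
    (Finset.sum_congr rfl fun i _ => by rw [mul_left_comm])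

-- Clearing denominators gives equality only off the zeros of `Q₂`; after multiplication by `Q₂` it
-- holds everywhere, and the factor is then cancelled.
open Polynomial in
theorem IsLameCoeffs.exists_weightedDerivative {p : ℕ} {Q₂ Q₁ : ℂ[X]} (h : IsLameCoeffs p Q₂ Q₁) :
    ∃ (ζ : Fin p → ℂ) (a : Fin p → ℝ), (∀ l, 0 < a l) ∧ Q₂ = ∏ l, (X - C (ζ l)) ∧
      Q₁ = weightedDerivative ζ a := by
  obtain ⟨ζ, a, ha, hQ, h⟩ := h
  refine ⟨ζ, a, ha, hQ, ?_⟩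
  have hQ0 : Q₂ ≠ 0 := by
    rw [hQ]
    exact (monic_prod_of_monic _ _ fun l _ => monic_X_sub_C _).ne_zero
  refine mul_left_cancel₀ hQ0 (Polynomial.funext fun z => ?_)
  rw [eval_mul, eval_mul]
  by_cases hz : Q₂.eval z = 0
  · simp [hz]
  · congr 1
    rw [(div_eq_iff hz).1 (h z hz), weightedDerivative, eval_finsetSum, Finset.sum_mul]
    refine Finset.sum_congr rfl fun l _ => ?_
    have hl : z - ζ l ≠ 0 := by
      intro h0
      apply hz
      rw [hQ, eval_prod]
      exact Finset.prod_eq_zero (Finset.mem_univ l) (by simpa using h0)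
    rw [hQ, eval_prod, eval_mul, eval_C, eval_prod, ← Finset.mul_prod_erase _ _ (Finset.mem_univ l),
      ← mul_assoc]
    congr 1
    simp only [eval_sub, eval_X, eval_C]
    exact div_mul_cancel₀ _ hl

/-- If `v` and `s` are averages of `w` and `z` with column sums less than one, and `w` are averages
of `s`, then `s` lies in any closed convex set containing `z`. -/
theorem mem_of_strict_averages {ι κ σ τ : Type*} [Fintype ι] [Fintype κ] [Fintype σ] [Fintype τ]
    {v : ι → ℂ} {s : σ → ℂ} {w : τ → ℂ} {z : κ → ℂ} (hws : Averages w s)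
    (A : ι ⊕ σ → τ ⊕ κ → ℝ) (hA : ∀ i j, 0 ≤ A i j) (hA1 : ∀ i, ∑ j, A i j = 1)
    (hA2 : ∀ j, ∑ i, A i j < 1)
    (hA3 : ∀ i, Sum.elim v s i = ∑ j, (A i j : ℂ) * Sum.elim w z j)
    {L : Set ℂ} (hL : Convex ℝ L) (hLc : IsClosed L) (hz : ∀ j, z j ∈ L) (i : σ) : s i ∈ L := by
  by_contra hi
  obtain ⟨f, u, hf, hu⟩ := geometric_hahn_banach_closed_point hL hLc hi
  -- The positive part of a separating functional: convex, nonnegative, zero on all `z j`, and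
  -- positive at the point `s i` assumed to lie outside `L`.
  let g : ℂ → ℝ := fun x => max 0 (f x - u)
  have hg : ConvexOn ℝ Set.univ g := by
    refine ConvexOn.sup (convexOn_const 0 convex_univ) ?_
    exact (f.toLinearMap.convexOn convex_univ).sub (concaveOn_const u convex_univ)
  have hg0 : ∀ x, 0 ≤ g x := fun x => le_max_left _ _
  have hgz : ∀ j, g (z j) = 0 := fun j => max_eq_left (by linarith [hf _ (hz j)])
  have hgs : ∑ i, g (w i) ≤ ∑ i, g (s i) := hws.sum_le hg (fun x _ => hg0 x) fun _ => trivial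
  have hsum : ∑ j, g (s j) ≤ ∑ j, (∑ i, A i (Sum.inl j)) * g (w j) := by
    calc ∑ j, g (s j) ≤ ∑ i, g (Sum.elim v s i) := by
          rw [Fintype.sum_sum_type]
          simpa using Finset.sum_nonneg fun i _ => hg0 (v i)
      _ ≤ ∑ i, ∑ j, A i j * g (Sum.elim w z j) := by
          refine Finset.sum_le_sum fun i _ => ?_
          rw [hA3]
          simp_rw [← Complex.real_smul]
          exact hg.map_sum_le (fun j _ => hA i j) (hA1 i) fun j _ => trivial
      _ = ∑ j, (∑ i, A i j) * g (Sum.elim w z j) := by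
          rw [Finset.sum_comm]
          simp_rw [Finset.sum_mul]
      _ = _ := by
          rw [Fintype.sum_sum_type]
          simp [hgz]
  -- Otherwise the strict column sums would give `∑ g(w) ≤ ∑ g(s) < ∑ g(w)`.
  have hgw : ∀ j, g (w j) = 0 := by
    by_contra! h
    obtain ⟨j, hj⟩ := h
    refine lt_irrefl (∑ i, g (w i)) (hgs.trans_lt (hsum.trans_lt ?_))
    refine Finset.sum_lt_sum (fun j _ => mul_le_of_le_one_left (hg0 _) (hA2 _).le)
      ⟨j, Finset.mem_univ j, ?_⟩
    exact mul_lt_of_lt_one_left (lt_of_le_of_ne (hg0 _) hj.symm) (hA2 _)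
  simp only [hgw, mul_zero, Finset.sum_const_zero] at hsum
  have h1 : g (s i) ≤ 0 :=
    (Finset.single_le_sum (f := fun i => g (s i)) (fun i _ => hg0 _) (Finset.mem_univ i)).trans hsum
  exact absurd ((le_max_right _ _).trans h1) (by linarith)

open Polynomial in
/-- The zeros of a higher Van Vleck polynomial are averages of the zeros of `Q₂`, and away from the
convex hull of those zeros `V` is bounded below by a constant multiple of `Q₂`. -/
theorem IsNormalizedSpectralPair.exists_averages {k p n : ℕ} (hk : 1 ≤ k) {Q₂ Q₁ V S : ℂ[X]}
    {ζ : Fin p → ℂ} {a : Fin p → ℝ} (ha : ∀ l, 0 < a l) (hQ₂ : Q₂ = ∏ l, (X - C (ζ l)))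
    (hQ₁ : Q₁ = weightedDerivative ζ a) (h : IsNormalizedSpectralPair k p n Q₂ Q₁ V S) :
    ∃ v : Fin (p - k) → ℂ, V = ∏ i, (X - C (v i)) ∧ Averages v ζ ∧
      ∀ L : Set ℂ, Convex ℝ L → IsClosed L → (∀ l, ζ l ∈ L) →
        ∀ z e : ℂ, z ∉ L → ∀ b : ℝ, 0 ≤ b → ‖e‖ = 1 →
        (∀ x ∈ L, b ≤ (e / (z - x)).re) →
        b ^ k * ∏ l, ‖z - ζ l‖ ≤ ∏ i, ‖z - v i‖ := by
  obtain ⟨hSm, hVm, hVd, W, hW, hVW⟩ := h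
  have hkp := hW.fuchs
  have hW0 : W ≠ 0 := by
    rintro rfl
    exact hVm.ne_zero (by simpa using hVW)
  have hlc : W.leadingCoeff ≠ 0 := leadingCoeff_ne_zero.2 hW0
  have hWV : W = C W.leadingCoeff * V := by
    conv_rhs => rw [hVW, ← mul_assoc, ← C_mul, mul_inv_cancel₀ hlc, C_1, one_mul]
  -- If `n < k - 1`, both derivatives vanish and the equation reduces to `W S = 0`.
  have hkn : k - 1 ≤ n := by
    by_contra! hlt
    have h1 : derivative^[k - 1] S = 0 :=
      iterate_derivative_eq_zero (by rw [hW.degree_S]; exact hlt)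
    have h2 : derivative^[k] S = 0 :=
      iterate_derivative_eq_zero (by rw [hW.degree_S]; omega)
    have := hW.equation
    rw [h1, h2, mul_zero, mul_zero, add_zero, zero_add] at this
    exact mul_ne_zero hW0 hW.S_ne_zero this
  obtain ⟨s, hs⟩ := exists_eq_prod_X_sub_C (κ := Fin n) hSm (by simpa using hW.degree_S)
  obtain ⟨v, hv⟩ := exists_eq_prod_X_sub_C (κ := Fin (p - k)) hVm (by simpa using hVd)
  obtain ⟨w, c, hc, hw, hws, hwb⟩ := iterate_derivative_prod s (k - 1) hkn
  rw [← hs] at hw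
  have hw' : derivative^[k] S = C c * weightedDerivative w 1 := by
    conv_lhs => rw [← Nat.sub_add_cancel hk, Function.iterate_succ_apply']
    rw [hw, derivative_C_mul, weightedDerivative_one]
  have heq : weightedDerivative (Sum.elim w ζ) (Sum.elim 1 a) =
      C (-(c⁻¹ * W.leadingCoeff)) * (V * S) := by
    have h1 := hW.equation
    rw [hw, hw', hQ₁, hQ₂] at h1
    rw [weightedDerivative_sum_elim]
    have hcc : C c⁻¹ * C c = (1 : ℂ[X]) := by rw [← C_mul, inv_mul_cancel₀ hc, C_1]
    rw [C_neg, C_mul]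
    have h2 : C c⁻¹ * W * S = C c⁻¹ * C W.leadingCoeff * (V * S) := by
      conv_lhs => rw [hWV]
      ring
    linear_combination C c⁻¹ * h1 - h2 - (weightedDerivative w 1 * ∏ l, (X - C (ζ l)) +
      (∏ i, (X - C (w i))) * weightedDerivative ζ a) * hcc
  -- Both truncated subtractions are genuine here, by `hkn` and `k ≤ p`; a weighted derivative has
  -- one zero fewer than the number of points.
  have hcard : Fintype.card (Fin (n - (k - 1)) ⊕ Fin p) =
      Fintype.card (Fin (p - k) ⊕ Fin n) + 1 := by
    simp only [Fintype.card_sum, Fintype.card_fin]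
    omega
  have hα : ∀ i, 0 < (Sum.elim 1 a : Fin (n - (k - 1)) ⊕ Fin p → ℝ) i := by
    rintro (i | i)
    · exact one_pos
    · exact ha i
  obtain ⟨ht, hA⟩ := weightedDerivative_spec hcard _ _ hα (hVm.mul hSm) heq
  obtain ⟨A, hA, hA1, hA2, hA3⟩ := hA (Sum.elim v s) (by
    rw [Fintype.prod_sum_type, hv, hs]
    rfl)
  have hsum : Averages (Sum.elim v s) (Sum.elim w ζ) := ⟨A, hA, hA1, fun j => (hA2 j).le, hA3⟩
  -- Replacing `w` by `s` on the right makes `s` common to both sides, hence cancellable.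
  refine ⟨v, hv, (hsum.trans (hws.sum_elim ζ)).cancel, fun L hL hLc hζ z e hz b hb he hbL => ?_⟩
  have hsL : ∀ i, s i ∈ L := mem_of_strict_averages hws A hA hA1 hA2 hA3 hL hLc hζ
  have hwL := hws.mem hL hsL
  have hxL : ∀ i, Sum.elim w ζ i ∈ L := by
    rintro (i | i)
    · exact hwL i
    · exact hζ i
  have h1 := norm_eval_weightedDerivative_ge _ _ (fun i => (hα i).le) he
    (fun i (hi : z = Sum.elim w ζ i) => hz (hi ▸ hxL i)) (fun i => hbL _ (hxL i))
  have h2 := hwb L hL hsL z e hz b hb he hbL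
  have ht0 : 0 < ∑ i, (Sum.elim 1 a : Fin (n - (k - 1)) ⊕ Fin p → ℝ) i := by
    have : 0 < p := by omega
    exact Finset.sum_pos (fun i _ => hα i) ⟨Sum.inr ⟨0, this⟩, Finset.mem_univ _⟩
  rw [heq, ht, eval_mul, eval_C, norm_mul, Complex.norm_real, Real.norm_of_nonneg ht0.le,
    mul_comm b, mul_assoc, mul_le_mul_iff_right₀ ht0, eval_mul, hv, hs, eval_prod, eval_prod,
    norm_mul, norm_prod, norm_prod, Fintype.prod_sum_type] at h1
  simp only [eval_sub, eval_X, eval_C, Sum.elim_inl, Sum.elim_inr] at h1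
  have hS0 : 0 < ∏ i, ‖z - s i‖ := Finset.prod_pos fun i _ =>
    norm_pos_iff.2 (sub_ne_zero.2 fun hi => hz (hi ▸ hsL i))
  refine le_of_mul_le_mul_right ?_ hS0
  calc b ^ k * (∏ l, ‖z - ζ l‖) * ∏ i, ‖z - s i‖
      = b * ((b ^ (k - 1) * ∏ i, ‖z - s i‖) * ∏ l, ‖z - ζ l‖) := by
        have : b ^ k = b * b ^ (k - 1) := by
          rw [← pow_succ', Nat.sub_add_cancel hk]
        rw [this]
        ring
    _ ≤ b * ((∏ i, ‖z - w i‖) * ∏ l, ‖z - ζ l‖) := by gcongr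
    _ ≤ _ := h1

/-! ### Convexity in finite dimension -/

/-- Carathéodory's theorem with a fixed number of points. -/
theorem convexHull_eq_image_stdSimplex_prod {E : Type*} [AddCommGroup E] [Module ℝ E]
    [FiniteDimensional ℝ E] {K : Set E} (hK : K.Nonempty) :
    convexHull ℝ K = (fun q : (Fin (Module.finrank ℝ E + 1) → ℝ) ×
        (Fin (Module.finrank ℝ E + 1) → E) => ∑ i, q.1 i • q.2 i) ''
      (stdSimplex ℝ (Fin (Module.finrank ℝ E + 1)) ×ˢ Set.univ.pi fun _ => K) := by
  classical
  apply Set.Subset.antisymm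
  · intro x hx
    obtain ⟨ι, _, y, w, hy, hai, hw, hw1, rfl⟩ := eq_pos_convex_span_of_mem_convexHull hx
    obtain ⟨x₀, hx₀⟩ := hK
    have hcard : Fintype.card ι ≤ Fintype.card (Fin (Module.finrank ℝ E + 1)) := by
      rw [Fintype.card_fin]
      exact hai.card_le_finrank_succ.trans
        (Nat.add_le_add_right (Submodule.finrank_le _) 1)
    obtain ⟨e⟩ := Function.Embedding.nonempty_of_card_le hcard
    have hex : ∀ i, Function.extend e w 0 (e i) = w i := e.injective.extend_apply w 0
    have hey : ∀ i, Function.extend e y (fun _ => x₀) (e i) = y i := e.injective.extend_apply y _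
    have hout : ∀ j ∉ Set.range e, Function.extend e w 0 j = 0 := fun j hj =>
      Function.extend_apply' _ _ _ hj
    -- Unused slots get weight `0` and the arbitrary point `x₀ ∈ K`.
    refine ⟨(Function.extend e w 0, Function.extend e y fun _ => x₀), ⟨⟨fun j => ?_, ?_⟩, ?_⟩, ?_⟩
    · by_cases hj : j ∈ Set.range e
      · obtain ⟨i, rfl⟩ := hj
        exact (hw i).le.trans_eq (hex i).symm
      · exact (hout j hj).ge
    · rw [← hw1]
      exact (Fintype.sum_of_injective e e.injective _ _ (fun j hj => hout j hj)
        fun i => (hex i).symm).symm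
    · rintro j -
      by_cases hj : j ∈ Set.range e
      · obtain ⟨i, rfl⟩ := hj
        simp only [hey]
        exact hy ⟨i, rfl⟩
      · simp only [Function.extend_apply' _ _ _ hj]
        exact hx₀
    · exact (Fintype.sum_of_injective e e.injective _ _
        (fun j hj => by simp only [hout j hj, zero_smul])
        fun i => by simp only [hex, hey]).symm
  · rintro _ ⟨⟨w, y⟩, ⟨⟨hw, hw1⟩, hy⟩, rfl⟩
    exact (convex_convexHull ℝ K).sum_mem (fun i _ => hw i) hw1
      fun i _ => subset_convexHull ℝ K (hy i trivial)

theorem isCompact_convexHull {E : Type*} [AddCommGroup E] [Module ℝ E] [TopologicalSpace E]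
    [ContinuousAdd E] [ContinuousSMul ℝ E] [FiniteDimensional ℝ E] {K : Set E}
    (hK : IsCompact K) : IsCompact (convexHull ℝ K) := by
  rcases K.eq_empty_or_nonempty with rfl | hne
  · simp
  rw [convexHull_eq_image_stdSimplex_prod hne]
  exact ((isCompact_stdSimplex ℝ _).prod (isCompact_univ_pi fun _ => hK)).image (by fun_prop)

/-- The points `1 / (z - x)`, `x ∈ L`, lie in a half-plane at positive distance from the origin. -/
theorem exists_le_re_div {L : Set ℂ} (hL : Convex ℝ L) (hLc : IsCompact L) {z : ℂ} (hz : z ∉ L) :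
    ∃ (e : ℂ) (b : ℝ), 0 < b ∧ ‖e‖ = 1 ∧ ∀ x ∈ L, b ≤ (e / (z - x)).re := by
  rcases L.eq_empty_or_nonempty with rfl | ⟨x₀, hx₀⟩
  · exact ⟨1, 1, one_pos, by simp, by simp⟩
  obtain ⟨f, u, hf, hu⟩ := geometric_hahn_banach_closed_point hL hLc.isClosed hz
  obtain ⟨D, hD⟩ := hLc.isBounded.exists_norm_le
  -- `a` represents the separating functional as a real inner product, so `Re (a / (z - x)) = f (z -
  -- x) / |z - x|²`. The constant below combines the separation gap with a bound for `|z - x|`.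
  set a : ℂ := ⟨f 1, f Complex.I⟩ with ha
  have hfa : ∀ w : ℂ, f w = w.re * a.re + w.im * a.im := fun w => by
    conv_lhs => rw [← Complex.re_add_im w, mul_comm, ← mul_one (w.re : ℂ), ← smul_eq_mul (w.re : ℂ),
      mul_comm Complex.I, ← smul_eq_mul (w.im : ℂ), Complex.coe_smul, Complex.coe_smul, map_add,
      map_smul, map_smul]
    simp [ha]
  have ha0 : 0 < ‖a‖ := by
    rw [norm_pos_iff]
    intro h0
    have h1 := hfa z
    have h2 := hfa x₀
    simp only [h0, Complex.zero_re, Complex.zero_im, mul_zero, add_zero] at h1 h2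
    linarith [hf x₀ hx₀]
  have hM : 0 < (‖z‖ + D + 1) ^ 2 := by
    have := (norm_nonneg x₀).trans (hD x₀ hx₀)
    positivity
  refine ⟨a / ‖a‖, (f z - u) / ((‖z‖ + D + 1) ^ 2 * ‖a‖), div_pos (by linarith) (by positivity),
    by simp [ha0.ne'], fun x hx => ?_⟩
  have hzx : z - x ≠ 0 := sub_ne_zero.2 fun h => hz (h ▸ hx)
  have hn : 0 < ‖z - x‖ ^ 2 := by positivity
  have h1 : (a / ‖a‖ / (z - x)).re = f (z - x) / (‖z - x‖ ^ 2 * ‖a‖) := by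
    rw [div_right_comm, Complex.div_ofReal_re, Complex.div_re, hfa, Complex.normSq_eq_norm_sq]
    field_simp
  rw [h1]
  have h2 : ‖z - x‖ ≤ ‖z‖ + D + 1 := by
    linarith [norm_sub_le z x, hD x hx]
  have h3 : f z - u ≤ f (z - x) := by
    rw [map_sub]
    linarith [hf x hx]
  gcongr
  linarith

/-! ### Measures concentrated on a compact set -/

/-- A finitely supported probability measure. -/
theorem exists_discrete_probabilityMeasure {τ X : Type*} [Fintype τ] [MeasurableSpace X]
    [MeasurableSingletonClass X] (w : τ → ℝ) (hw : ∀ t, 0 ≤ w t) (hw1 : ∑ t, w t = 1)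
    (x : τ → X) :
    ∃ m : ProbabilityMeasure X, ∀ g : X → ℝ, ∫ y, g y ∂(m : Measure X) = ∑ t, w t * g (x t) := by
  have hp : IsProbabilityMeasure (∑ t, ENNReal.ofReal (w t) • Measure.dirac (x t)) := by
    constructor
    simp only [Measure.coe_finsetSum, Finset.sum_apply, Measure.smul_apply, measure_univ,
      smul_eq_mul, mul_one]
    rw [← ENNReal.ofReal_sum_of_nonneg fun t _ => hw t, hw1, ENNReal.ofReal_one]
  refine ⟨⟨_, hp⟩, fun g => ?_⟩
  rw [ProbabilityMeasure.coe_mk, integral_finsetSum_measure fun t _ =>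
    (integrable_dirac (by simp)).smul_measure ENNReal.ofReal_ne_top]
  refine Finset.sum_congr rfl fun t _ => ?_
  rw [integral_smul_measure, integral_dirac, ENNReal.toReal_ofReal (hw t), smul_eq_mul]

theorem restrict_eq_self_of_mem_probOn {L : Set ℂ} {μ : Measure ℂ} (hμ : μ ∈ probOn L) :
    μ.restrict L = μ :=
  Measure.restrict_eq_self_of_ae_mem (by rw [ae_iff]; exact hμ.2)

theorem exists_probabilityMeasure_of_mem_probOn {L : Set ℂ} (hL : MeasurableSet L) {μ : Measure ℂ}
    (hμ : μ ∈ probOn L) : ∃ m : ProbabilityMeasure L,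
      ∀ f : ℂ → ℝ, ∫ w in L, f w ∂μ = ∫ x : L, f x ∂(m : Measure L) := by
  have hmap : (μ.comap Subtype.val : Measure L).map Subtype.val = μ := by
    rw [map_comap_subtype_coe hL, restrict_eq_self_of_mem_probOn hμ]
  have hp : IsProbabilityMeasure (μ.comap Subtype.val : Measure L) := by
    have := hμ.1
    rw [← hmap] at this
    exact Measure.isProbabilityMeasure_of_map Subtype.val
  exact ⟨⟨_, hp⟩, fun f => (integral_subtype_comap hL f).symm⟩

theorem map_coe_mem_probOn {L : Set ℂ} (hL : MeasurableSet L) (m : Measure L)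
    [IsProbabilityMeasure m] : m.map Subtype.val ∈ probOn L := by
  refine ⟨Measure.isProbabilityMeasure_map measurable_subtype_coe.aemeasurable, ?_⟩
  rw [Measure.map_apply measurable_subtype_coe hL.compl]
  simp

theorem setIntegral_map_coe {L : Set ℂ} (hL : MeasurableSet L) {E : Type*} [NormedAddCommGroup E]
    [NormedSpace ℝ E] (m : Measure L) [IsProbabilityMeasure m] (f : ℂ → E) :
    ∫ w in L, f w ∂(m.map Subtype.val) = ∫ x : L, f x ∂m := by
  rw [restrict_eq_self_of_mem_probOn (map_coe_mem_probOn hL m)]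
  exact (MeasurableEmbedding.subtype_coe hL).integral_map f

theorem exists_boundedContinuous_eq {L : Set ℂ} (hLc : IsCompact L) {f : ℂ → ℝ}
    (hf : ContinuousOn f L) : ∃ g : BoundedContinuousFunction L ℝ, ∀ x : L, g x = f x := by
  have : CompactSpace L := isCompact_iff_compactSpace.1 hLc
  exact ⟨BoundedContinuousFunction.mkOfCompact ⟨_, hf.domRestrict⟩, fun x => rfl⟩

theorem exists_continuousOn_eq {L : Set ℂ} (g : BoundedContinuousFunction L ℝ) :
    ∃ f : ℂ → ℝ, ContinuousOn f L ∧ ∀ x : L, f x = g x := by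
  classical
  refine ⟨fun w => if h : w ∈ L then g ⟨w, h⟩ else 0, ?_, fun x => by simp⟩
  rw [continuousOn_iff_continuous_domRestrict]
  convert g.continuous with x
  simp

theorem isWeakStarLimit_map_coe {L : Set ℂ} (hLc : IsCompact L) {Γ : Set ℕ} {ν : ℕ → Measure ℂ}
    {M : ℕ → ProbabilityMeasure L} {m : ProbabilityMeasure L}
    (hM : Tendsto M (atTop ⊓ 𝓟 Γ) (𝓝 m))
    (hν : ∀ᶠ p in atTop ⊓ 𝓟 Γ, ∀ f : ℂ → ℝ, ∫ w in L, f w ∂(ν p) = ∫ x : L, f x ∂(M p : Measure L)) :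
    IsWeakStarLimit L Γ ν ((m : Measure L).map Subtype.val) := by
  refine ⟨map_coe_mem_probOn hLc.measurableSet _, fun f hf => ?_⟩
  obtain ⟨g, hg⟩ := exists_boundedContinuous_eq hLc hf
  have h := ProbabilityMeasure.tendsto_iff_forall_integral_tendsto.1 hM g
  simp only [hg] at h
  rw [setIntegral_map_coe hLc.measurableSet]
  exact h.congr' (hν.mono fun p hp => (hp f).symm)

/-- Translates convergence along a subsequence into convergence along the set of its indices, the
form used for weak-* limits. -/
theorem map_atTop_of_strictMono {ψ : ℕ → ℕ} (hψ : StrictMono ψ) :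
    map ψ atTop = atTop ⊓ 𝓟 (Set.range ψ) := by
  rw [← map_comap, comap_embedding_atTop (fun _ _ => hψ.le_iff_le) fun c => ⟨c, hψ.le_apply⟩]

/-- Two sequences of probability measures on a compact set have weak-* limits along a common
subsequence. -/
theorem exists_isWeakStarLimit {L : Set ℂ} (hLc : IsCompact L) {ν₁ ν₂ : ℕ → Measure ℂ} {k : ℕ}
    (h₁ : ∀ p, k < p → ν₁ p ∈ probOn L) (h₂ : ∀ p, k < p → ν₂ p ∈ probOn L) {Γ₀ : Set ℕ}
    (hΓ₀ : Γ₀.Infinite) : ∃ Γ : Set ℕ, Γ ⊆ Γ₀ ∧ Γ.Infinite ∧ ∃ μ₁ μ₂ : Measure ℂ,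
      IsWeakStarLimit L Γ ν₁ μ₁ ∧ IsWeakStarLimit L Γ ν₂ μ₂ := by
  have : CompactSpace L := isCompact_iff_compactSpace.1 hLc
  obtain ⟨e, he, heΓ⟩ := Nat.exists_strictMono_subsequence (P := fun p => p ∈ Γ₀ ∧ k < p)
    fun N => by
      obtain ⟨p, hp, hlt⟩ := hΓ₀.exists_gt (max N k)
      exact ⟨p, (le_max_left _ _).trans_lt hlt, hp, (le_max_right _ _).trans_lt hlt⟩
  have hex : ∀ ν : ℕ → Measure ℂ, (∀ p, k < p → ν p ∈ probOn L) →
      ∀ p, ∃ m : ProbabilityMeasure L, k < p →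
        ∀ f : ℂ → ℝ, ∫ w in L, f w ∂(ν p) = ∫ x : L, f x ∂(m : Measure L) := by
    intro ν hν p
    by_cases hp : k < p
    · obtain ⟨m, hm⟩ := exists_probabilityMeasure_of_mem_probOn hLc.measurableSet (hν p hp)
      exact ⟨m, fun _ => hm⟩
    · obtain ⟨m, -⟩ := exists_probabilityMeasure_of_mem_probOn hLc.measurableSet
        (hν (k + 1) k.lt_succ_self)
      exact ⟨m, fun h => absurd h hp⟩
  choose M₁ hM₁ using hex ν₁ h₁
  choose M₂ hM₂ using hex ν₂ h₂
  obtain ⟨⟨m₁, m₂⟩, φ, hφ, hlim⟩ := CompactSpace.tendsto_subseq fun j => (M₁ (e j), M₂ (e j))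
  have hψ : StrictMono (e ∘ φ) := he.comp hφ
  have hev : ∀ᶠ p in atTop ⊓ 𝓟 (Set.range (e ∘ φ)), k < p := by
    rw [← map_atTop_of_strictMono hψ, eventually_map]
    exact Eventually.of_forall fun j => (heΓ _).2
  have hlim₁ : Tendsto M₁ (atTop ⊓ 𝓟 (Set.range (e ∘ φ))) (𝓝 m₁) := by
    rw [← map_atTop_of_strictMono hψ, tendsto_map'_iff]
    exact (continuous_fst.tendsto _).comp hlim
  have hlim₂ : Tendsto M₂ (atTop ⊓ 𝓟 (Set.range (e ∘ φ))) (𝓝 m₂) := by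
    rw [← map_atTop_of_strictMono hψ, tendsto_map'_iff]
    exact (continuous_snd.tendsto _).comp hlim
  refine ⟨Set.range (e ∘ φ), Set.range_subset_iff.2 fun j => (heΓ _).1,
    Set.infinite_range_of_injective hψ.injective, _, _,
    isWeakStarLimit_map_coe hLc hlim₁ (hev.mono hM₁),
    isWeakStarLimit_map_coe hLc hlim₂ (hev.mono hM₂)⟩

/-- The root-counting measure of a product of linear factors. -/
theorem rootMeasure_prod {κ : Type*} [Fintype κ] [Nonempty κ] {L : Set ℂ} (hL : MeasurableSet L)
    (x : κ → ℂ) (hx : ∀ i, x i ∈ L) :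
    rootMeasure (∏ i, (Polynomial.X - Polynomial.C (x i))) ∈ probOn L ∧ ∀ f : ℂ → ℝ,
      ∫ w in L, f w ∂(rootMeasure (∏ i, (Polynomial.X - Polynomial.C (x i)))) =
        (Fintype.card κ : ℝ)⁻¹ * ∑ i, f (x i) := by
  have hroots : (∏ i, (Polynomial.X - Polynomial.C (x i))).roots = Finset.univ.val.map x := by
    rw [← Polynomial.roots_multiset_prod_X_sub_C (Finset.univ.val.map x), Multiset.map_map]
    rfl
  have hμ : rootMeasure (∏ i, (Polynomial.X - Polynomial.C (x i))) =
      (Fintype.card κ : ENNReal)⁻¹ • ∑ i, Measure.dirac (x i) := by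
    rw [rootMeasure, hroots, Multiset.map_map, Multiset.card_map]
    rfl
  rw [hμ]
  have hc0 : (Fintype.card κ : ENNReal) ≠ 0 := by simp
  have hmem : (Fintype.card κ : ENNReal)⁻¹ • ∑ i, Measure.dirac (x i) ∈ probOn L := by
    refine ⟨⟨?_⟩, ?_⟩
    · simp only [Measure.smul_apply, Measure.coe_finsetSum, Finset.sum_apply, measure_univ,
        smul_eq_mul, Finset.sum_const, Finset.card_univ, nsmul_eq_mul, mul_one]
      exact ENNReal.inv_mul_cancel hc0 (ENNReal.natCast_ne_top _)
    · simp [Measure.dirac_apply' _ hL.compl, hx]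
  refine ⟨hmem, fun f => ?_⟩
  rw [restrict_eq_self_of_mem_probOn hmem, integral_smul_measure,
    integral_finsetSum_measure fun t _ => integrable_dirac (by simp)]
  simp

/-! ### Martingale couplings and dilations -/

/-- A bounded function which is orthogonal to the bounded continuous functions vanishes. -/
theorem ae_eq_zero_of_forall_integral_mul_eq_zero {X : Type*} [TopologicalSpace X] [NormalSpace X]
    [MeasurableSpace X] [BorelSpace X] {m : Measure X} [IsFiniteMeasure m] [m.WeaklyRegular]
    {h : X → ℝ} (hm : Measurable h) {C : ℝ} (hC : ∀ x, |h x| ≤ C)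
    (horth : ∀ g : BoundedContinuousFunction X ℝ, ∫ x, g x * h x ∂m = 0) : h =ᵐ[m] 0 := by
  have hint : Integrable h m := Integrable.of_bound hm.aestronglyMeasurable C
    (Eventually.of_forall hC)
  have hsq : Integrable (fun x => h x * h x) m :=
    hint.mul_bdd (c := C) hm.aestronglyMeasurable (Eventually.of_forall hC)
  have hle : ∫ x, h x * h x ∂m ≤ 0 := by
    refine le_of_forall_pos_le_add fun ε hε => ?_
    have hC1 : 0 < |C| + 1 := by positivity
    -- With `g` close to `h` in `L¹`, orthogonality gives `∫ h² = ∫ (h - g) h ≤ ε`.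
    obtain ⟨g, hg, hgi⟩ := hint.exists_boundedContinuous_integral_sub_le (div_pos hε hC1)
    have hgh : Integrable (fun x => g x * h x) m :=
      hgi.mul_bdd (c := C) hm.aestronglyMeasurable (Eventually.of_forall hC)
    calc ∫ x, h x * h x ∂m = ∫ x, h x * h x ∂m - ∫ x, g x * h x ∂m := by rw [horth g, sub_zero]
      _ = ∫ x, (h x * h x - g x * h x) ∂m := (integral_sub hsq hgh).symm
      _ ≤ ∫ x, ‖h x - g x‖ * (|C| + 1) ∂m := by
          refine integral_mono (hsq.sub hgh) ((hint.sub hgi).norm.mul_const _) fun x => ?_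
          calc h x * h x - g x * h x = (h x - g x) * h x := by ring
            _ ≤ |(h x - g x) * h x| := le_abs_self _
            _ = ‖h x - g x‖ * |h x| := abs_mul _ _
            _ ≤ ‖h x - g x‖ * (|C| + 1) := by
              gcongr
              linarith [hC x, le_abs_self C]
      _ ≤ ε / (|C| + 1) * (|C| + 1) := by
          rw [integral_mul_const]
          gcongr
      _ = 0 + ε := by
          rw [div_mul_cancel₀ _ hC1.ne', zero_add]
  have h0 := (integral_eq_zero_iff_of_nonneg (fun x => mul_self_nonneg (h x)) hsq).1
    (le_antisymm hle (integral_nonneg fun x => mul_self_nonneg (h x)))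
  filter_upwards [h0] with x hx
  exact mul_self_eq_zero.1 hx

/-- A coupling of `μ` and `ν` which is a one-step martingale disintegrates into a dilation taking
`μ` to `ν`. -/
theorem exists_isDilation_of_coupling {L : Set ℂ} (hLc : IsCompact L) (hLn : L.Nonempty)
    {μ ν : Measure ℂ} (hμ : μ ∈ probOn L) (π : ProbabilityMeasure (L × L))
    (h1 : ∀ f : ℂ → ℝ, ContinuousOn f L →
      ∫ q, f q.1 ∂(π : Measure (L × L)) = ∫ w in L, f w ∂μ)
    (h2 : ∀ f : ℂ → ℝ, ContinuousOn f L →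
      ∫ q, f q.2 ∂(π : Measure (L × L)) = ∫ w in L, f w ∂ν)
    (h3 : ∀ g : BoundedContinuousFunction L ℝ, ∀ l : ℂ →L[ℝ] ℝ,
      ∫ q, g q.1 * (l q.2 - l q.1) ∂(π : Measure (L × L)) = 0) :
    ∃ T : ℂ → Measure ℂ, IsDilation L T ∧ IsDilationOf L T μ ν := by
  classical
  have : CompactSpace L := isCompact_iff_compactSpace.1 hLc
  have : Nonempty L := hLn.to_subtype
  have hLm := hLc.measurableSet
  obtain ⟨D, hD⟩ := hLc.isBounded.exists_norm_le
  set ρ : Measure (L × L) := (π : Measure (L × L))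
  set κ := ρ.condKernel
  have hdis : ρ.fst.compProd κ = ρ := ρ.disintegrate κ
  obtain ⟨m, hm⟩ := exists_probabilityMeasure_of_mem_probOn hLm hμ
  have hfst : ρ.fst = (m : Measure L) := by
    refine ext_of_forall_integral_eq_of_IsFiniteMeasure fun g => ?_
    obtain ⟨f, hf, hfg⟩ := exists_continuousOn_eq g
    have := h1 f hf
    rw [hm] at this
    simp only [hfg] at this
    rw [← this, Measure.fst, integral_map measurable_fst.aemeasurable
      g.continuous.aestronglyMeasurable]
  have hcont : ∀ f : ℂ → ℝ, ContinuousOn f L → Continuous fun x : L => f x :=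
    fun f hf => hf.domRestrict
  have hval : ∀ x : L, Integrable (fun y : L => (y : ℂ)) (κ x) := fun x =>
    Integrable.of_bound continuous_subtype_val.aestronglyMeasurable D
      (Eventually.of_forall fun y => hD y y.2)
  have hbm : Measurable fun x : L => ∫ y : L, (y : ℂ) ∂(κ x) :=
    (StronglyMeasurable.integral_kernel
      continuous_subtype_val.stronglyMeasurable).measurable
  have hbn : ∀ x : L, ‖∫ y : L, (y : ℂ) ∂(κ x)‖ ≤ D := fun x => by
    simpa using norm_integral_le_of_norm_le_const (μ := κ x)
      (Eventually.of_forall fun y : L => hD y y.2)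
  -- The martingale identity says that the barycenter defect of `κ x`, seen through `l`, is
  -- orthogonal to all continuous `g`. Real and imaginary parts then give barycenter `x` almost
  -- everywhere.
  have hzero : ∀ l : ℂ →L[ℝ] ℝ,
      (fun x : L => l (∫ y : L, (y : ℂ) ∂(κ x)) - l x) =ᵐ[ρ.fst] 0 := by
    intro l
    refine ae_eq_zero_of_forall_integral_mul_eq_zero (C := ‖l‖ * D + ‖l‖ * D)
      ((l.continuous.measurable.comp hbm).sub (by fun_prop)) (fun x => ?_) fun g => ?_
    · refine (abs_sub _ _).trans (add_le_add ?_ ?_)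
      · exact (l.le_opNorm _).trans (by gcongr; exact hbn x)
      · exact (l.le_opNorm _).trans (by gcongr; exact hD x x.2)
    · rw [← h3 g l]
      conv_rhs => rw [← hdis]
      rw [Measure.integral_compProd]
      · refine integral_congr_ae (Eventually.of_forall fun x => ?_)
        simp only
        rw [integral_const_mul, integral_sub (l.integrable_comp (hval x)) (integrable_const _),
          l.integral_comp_comm (hval x)]
        simp
      · rw [hdis]
        have hc : Continuous fun q : L × L => g q.1 * (l q.2 - l q.1) := by fun_prop
        obtain ⟨B, hB⟩ := (isCompact_range hc).isBounded.exists_norm_le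
        exact Integrable.of_bound hc.aestronglyMeasurable B
          (Eventually.of_forall fun q => hB _ ⟨q, rfl⟩)
  have hbary : ∀ᵐ x ∂ρ.fst, ∫ y : L, (y : ℂ) ∂(κ x) = x := by
    filter_upwards [hzero Complex.reCLM, hzero Complex.imCLM] with x hre him
    exact Complex.ext (sub_eq_zero.1 hre) (sub_eq_zero.1 him)
  -- A dilation needs the barycenter condition at every point, so the kernel is replaced by `δ_x` on
  -- the exceptional null set.
  let T' : L → Measure L := fun x =>
    if ∫ y : L, (y : ℂ) ∂(κ x) = x then κ x else Measure.dirac x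
  have hT'p : ∀ x, IsProbabilityMeasure (T' x) := fun x => by
    simp only [T']
    split_ifs <;> infer_instance
  have hT'b : ∀ x, ∫ y : L, (y : ℂ) ∂(T' x) = x := fun x => by
    simp only [T']
    split_ifs with hx
    · exact hx
    · rw [integral_dirac]
  let T : ℂ → Measure ℂ := fun x => if h : x ∈ L then (T' ⟨x, h⟩).map Subtype.val else 0
  have hT : ∀ x : L, T x = (T' x).map Subtype.val := fun x => by
    simp [T]
  have hTi : ∀ (x : L) (f : ℂ → ℝ), ∫ w in L, f w ∂(T x) = ∫ y : L, f y ∂(T' x) := fun x f => by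
    rw [hT, setIntegral_map_coe hLm]
  refine ⟨T, ⟨fun x hx => ?_, fun x hx => ?_, fun f hf => ?_⟩, fun f hf => ?_⟩
  · rw [hT ⟨x, hx⟩]
    exact map_coe_mem_probOn hLm _
  · have hpr := map_coe_mem_probOn hLm (T' ⟨x, hx⟩)
    have := hpr.1
    rw [hT ⟨x, hx⟩]
    have h := setIntegral_map_coe hLm (T' ⟨x, hx⟩) (fun w : ℂ => w)
    rw [restrict_eq_self_of_mem_probOn hpr] at h ⊢
    rw [average_eq_integral, h]
    exact hT'b _
  · have hms : MeasurableSet {x : L | ∫ y : L, (y : ℂ) ∂(κ x) = x} :=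
      measurableSet_eq_fun hbm measurable_subtype_coe
    have hmk : Measurable fun x : L => ∫ y : L, f y ∂(κ x) :=
      (StronglyMeasurable.integral_kernel (hcont f hf).stronglyMeasurable).measurable
    have hite : Measurable fun x : L => if ∫ y : L, (y : ℂ) ∂(κ x) = x then
        ∫ y : L, f y ∂(κ x) else f x := Measurable.ite hms hmk (hcont f hf).measurable
    convert hite using 1
    funext x
    rw [hTi]
    simp only [T']
    split_ifs
    · rfl
    · rw [integral_dirac]
  · rw [hm, ← hfst, ← h2 f hf]
    simp only [hTi]
    conv_lhs => rw [← hdis]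
    rw [Measure.integral_compProd]
    · refine integral_congr_ae ?_
      filter_upwards [hbary] with x hx
      simp only [T', if_pos hx]
    · rw [hdis]
      have hc : Continuous fun q : L × L => f q.2 := (hcont f hf).comp continuous_snd
      obtain ⟨B, hB⟩ := (isCompact_range hc).isBounded.exists_norm_le
      exact Integrable.of_bound hc.aestronglyMeasurable B
        (Eventually.of_forall fun q => hB _ ⟨q, rfl⟩)

/-- A family `v` of averages of `z` gives a martingale coupling of the uniform measure on `v` with a
measure close to the uniform measure on `z`. -/
theorem Averages.exists_coupling {ι κ : Type*} [Fintype ι] [Fintype κ] [Nonempty ι] {v : ι → ℂ}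
    {z : κ → ℂ} (h : Averages v z) {L : Set ℂ} (hL : Convex ℝ L) (hz : ∀ j, z j ∈ L) :
    ∃ π : ProbabilityMeasure (L × L),
      (∀ f : ℂ → ℝ, ∫ q, f q.1 ∂(π : Measure (L × L)) =
        (Fintype.card ι : ℝ)⁻¹ * ∑ i, f (v i)) ∧
      (∀ (f : ℂ → ℝ) (C : ℝ), (∀ x ∈ L, |f x| ≤ C) →
        |Fintype.card ι * (∫ q, f q.2 ∂(π : Measure (L × L))) - ∑ j, f (z j)| ≤
          ((Fintype.card κ : ℝ) - Fintype.card ι) * C) ∧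
      ∀ (g : L → ℝ) (l : ℂ →L[ℝ] ℝ),
        ∫ q, g q.1 * (l q.2 - l q.1) ∂(π : Measure (L × L)) = 0 := by
  have hv := h.mem hL hz
  obtain ⟨A, hA, hA1, hA2, hA3⟩ := h
  set d : ℝ := (Fintype.card ι : ℝ) with hd
  have hd0 : 0 < d := by
    rw [hd]
    exact_mod_cast Fintype.card_pos
  -- Mass `A i j / d` at `(v i, z j)`. Row sums give the first marginal; the second is off by the
  -- column defects `1 - ∑ i, A i j`, whose total is `card κ - card ι`.
  obtain ⟨π, hπ⟩ := exists_discrete_probabilityMeasure (fun t : ι × κ => d⁻¹ * A t.1 t.2)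
    (fun t => mul_nonneg (inv_nonneg.2 hd0.le) (hA _ _)) (by
      rw [Fintype.sum_prod_type]
      simp_rw [← Finset.mul_sum, hA1]
      simp [← hd, hd0.ne'])
    (fun t => ((⟨v t.1, hv t.1⟩, ⟨z t.2, hz t.2⟩) : L × L))
  refine ⟨π, fun f => ?_, fun f C hC => ?_, fun g l => ?_⟩
  · rw [hπ fun q => f q.1, Fintype.sum_prod_type, Finset.mul_sum]
    refine Finset.sum_congr rfl fun i _ => ?_
    simp only
    rw [← Finset.sum_mul, ← Finset.mul_sum, hA1, mul_one]
  · have h1 : d * ∫ q, f q.2 ∂(π : Measure (L × L)) = ∑ j, (∑ i, A i j) * f (z j) := by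
      rw [hπ fun q => f q.2, Fintype.sum_prod_type, Finset.sum_comm, Finset.mul_sum]
      refine Finset.sum_congr rfl fun j _ => ?_
      simp only
      rw [← Finset.sum_mul, ← Finset.mul_sum, ← mul_assoc, ← mul_assoc, mul_inv_cancel₀ hd0.ne',
        one_mul]
    have h2 : ∑ j, ∑ i, A i j = d := by
      rw [Finset.sum_comm]
      simp [hA1, hd]
    have h3 : ((Fintype.card κ : ℝ) - d) * C = ∑ j, (1 - ∑ i, A i j) * C := by
      rw [← Finset.sum_mul, Finset.sum_sub_distrib, h2]
      simp
    rw [h1, ← Finset.sum_sub_distrib, h3]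
    refine (Finset.abs_sum_le_sum_abs _ _).trans (Finset.sum_le_sum fun j _ => ?_)
    rw [← sub_one_mul, abs_mul, abs_sub_comm, abs_of_nonneg (sub_nonneg.2 (hA2 j))]
    exact mul_le_mul_of_nonneg_left (hC _ (hz j)) (sub_nonneg.2 (hA2 j))
  · rw [hπ fun q => g q.1 * (l q.2 - l q.1), Fintype.sum_prod_type]
    refine Finset.sum_eq_zero fun i _ => ?_
    have h1 : ∑ j, A i j * l (z j) = l (v i) := by
      rw [hA3, map_sum]
      exact Finset.sum_congr rfl fun j _ => by rw [← Complex.real_smul, map_smul, smul_eq_mul]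
    calc ∑ j, d⁻¹ * A i j * (g ⟨v i, hv i⟩ * (l (z j) - l (v i)))
        = d⁻¹ * g ⟨v i, hv i⟩ * (∑ j, A i j * l (z j) - (∑ j, A i j) * l (v i)) := by
          rw [Finset.sum_mul, ← Finset.sum_sub_distrib, Finset.mul_sum]
          exact Finset.sum_congr rfl fun j _ => by ring
      _ = 0 := by rw [h1, hA1, one_mul, sub_self, mul_zero]

/-! ### Passage to the weak-* limits -/

section Limits

variable {k : ℕ} {L : Set ℂ} {Γ : Set ℕ} {v : ∀ p, Fin (p - k) → ℂ} {z : ∀ p, Fin p → ℂ}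
  {νV νQ : ℕ → Measure ℂ} {μ ν : Measure ℂ}

theorem neBot_atTop_inf_principal (hΓ : Γ.Infinite) : (atTop ⊓ 𝓟 Γ : Filter ℕ).NeBot := by
  rw [← frequently_mem_iff_neBot]
  exact Nat.frequently_atTop_iff_infinite.2 hΓ

theorem tendsto_sub_div_self (k : ℕ) (F : Filter ℕ) :
    Tendsto (fun p : ℕ => ((p - k : ℕ) : ℝ) / p) (atTop ⊓ F) (𝓝 1) := by
  have h : Tendsto (fun p : ℕ => 1 - (k : ℝ) / p) atTop (𝓝 (1 - 0)) :=
    tendsto_const_nhds.sub (tendsto_const_div_atTop_nhds_zero_nat _)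
  rw [sub_zero] at h
  refine (h.congr' ?_).mono_left inf_le_left
  filter_upwards [eventually_gt_atTop k] with p hp
  have hp0 : (p : ℝ) ≠ 0 := by
    have : p ≠ 0 := by omega
    exact_mod_cast this
  rw [Nat.cast_sub hp.le]
  field_simp

/-- Comparison of the weak-* limits from a comparison of sums over zeros. -/
theorem setIntegral_le_of_sum_le (hΓ : Γ.Infinite)
    (hV : ∀ p, k < p → ∀ f : ℂ → ℝ, ∫ w in L, f w ∂(νV p) = ((p - k : ℕ) : ℝ)⁻¹ * ∑ i, f (v p i))
    (hQ : ∀ p, k < p → ∀ f : ℂ → ℝ, ∫ w in L, f w ∂(νQ p) = (p : ℝ)⁻¹ * ∑ i, f (z p i))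
    (hμ : IsWeakStarLimit L Γ νV μ) (hν : IsWeakStarLimit L Γ νQ ν) {f : ℂ → ℝ}
    (hf : ContinuousOn f L) {e c : ℝ}
    (h : ∀ p, k < p → e * ∑ i, f (v p i) ≤ e * ∑ i, f (z p i) + c) :
    e * ∫ w in L, f w ∂μ ≤ e * ∫ w in L, f w ∂ν := by
  have := neBot_atTop_inf_principal hΓ
  -- The factor `(p - k) / p → 1` brings both measures to the common normalisation `1 / p`.
  have h1 := ((tendsto_sub_div_self k (𝓟 Γ)).mul (hμ.2 f hf)).const_mul e
  have h2 := ((hν.2 f hf).const_mul e).add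
    ((tendsto_const_div_atTop_nhds_zero_nat c).mono_left (inf_le_left (b := 𝓟 Γ)))
  rw [one_mul] at h1
  rw [add_zero] at h2
  refine le_of_tendsto_of_tendsto h1 h2 ?_
  filter_upwards [(eventually_gt_atTop k).filter_mono inf_le_left] with p hp
  have hp0 : 0 < (p : ℝ) := by
    have : 0 < p := by omega
    exact_mod_cast this
  have hd0 : ((p - k : ℕ) : ℝ) ≠ 0 := by
    have : p - k ≠ 0 := by omega
    exact_mod_cast this
  rw [hV p hp, hQ p hp]
  calc e * (((p - k : ℕ) : ℝ) / p * (((p - k : ℕ) : ℝ)⁻¹ * ∑ i, f (v p i)))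
      = (p : ℝ)⁻¹ * (e * ∑ i, f (v p i)) := by field_simp
    _ ≤ (p : ℝ)⁻¹ * (e * ∑ i, f (z p i) + c) := by
        gcongr
        exact h p hp
    _ = e * ((p : ℝ)⁻¹ * ∑ i, f (z p i)) + c / p := by ring

/-- Adding a bound `C` of `|f|` makes `f` nonnegative. Since the families have `p - k` and `p`
members, the shift leaves an error `k C`, which is `o(p)`. -/
theorem choquetLE_of_averages (hL : Convex ℝ L) (hLc : IsCompact L) (hΓ : Γ.Infinite)
    (hz : ∀ p, k < p → ∀ i, z p i ∈ L) (hvz : ∀ p, k < p → Averages (v p) (z p))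
    (hV : ∀ p, k < p → ∀ f : ℂ → ℝ, ∫ w in L, f w ∂(νV p) = ((p - k : ℕ) : ℝ)⁻¹ * ∑ i, f (v p i))
    (hQ : ∀ p, k < p → ∀ f : ℂ → ℝ, ∫ w in L, f w ∂(νQ p) = (p : ℝ)⁻¹ * ∑ i, f (z p i))
    (hμ : IsWeakStarLimit L Γ νV μ) (hν : IsWeakStarLimit L Γ νQ ν) : ChoquetLE L μ ν := by
  intro f hf hfc
  obtain ⟨C, hC⟩ := hLc.exists_bound_of_continuousOn hf
  have := setIntegral_le_of_sum_le (e := 1) (c := k * C) hΓ hV hQ hμ hν hf fun p hp => ?_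
  · simpa using this
  · have h1 := (hvz p hp).sum_le (f := fun x => f x + C) (hfc.add (convexOn_const C hL))
      (fun x hx => by linarith [neg_abs_le (f x), hC x hx, Real.norm_eq_abs (f x)]) (hz p hp)
    simp only [Finset.sum_add_distrib, Finset.sum_const, Finset.card_univ, Fintype.card_fin,
      nsmul_eq_mul] at h1
    rw [Nat.cast_sub hp.le] at h1
    linarith

/-- Compactness of the probability measures on `L × L` gives a limit coupling along an ultrafilter
finer than `Γ ∋ p → ∞`. Marginals and martingale identity are tested on continuous functions, so
they survive the limit, and the `O(1/p)` error in the second marginal disappears. -/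
theorem exists_isDilation_of_averages (hL : Convex ℝ L) (hLc : IsCompact L) (hΓ : Γ.Infinite)
    (hz : ∀ p, k < p → ∀ i, z p i ∈ L) (hvz : ∀ p, k < p → Averages (v p) (z p))
    (hV : ∀ p, k < p → ∀ f : ℂ → ℝ, ∫ w in L, f w ∂(νV p) = ((p - k : ℕ) : ℝ)⁻¹ * ∑ i, f (v p i))
    (hQ : ∀ p, k < p → ∀ f : ℂ → ℝ, ∫ w in L, f w ∂(νQ p) = (p : ℝ)⁻¹ * ∑ i, f (z p i))
    (hμ : IsWeakStarLimit L Γ νV μ) (hν : IsWeakStarLimit L Γ νQ ν) :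
    ∃ T : ℂ → Measure ℂ, IsDilation L T ∧ IsDilationOf L T μ ν := by
  have := neBot_atTop_inf_principal hΓ
  have : CompactSpace L := isCompact_iff_compactSpace.1 hLc
  have hcoup : ∀ p, k < p → ∃ π : ProbabilityMeasure (L × L),
      (∀ f : ℂ → ℝ, ∫ q, f q.1 ∂(π : Measure (L × L)) = ∫ w in L, f w ∂(νV p)) ∧
      (∀ (f : ℂ → ℝ) (C : ℝ), (∀ x ∈ L, |f x| ≤ C) →
        |((p - k : ℕ) : ℝ) / p * (∫ q, f q.2 ∂(π : Measure (L × L))) - ∫ w in L, f w ∂(νQ p)| ≤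
          k * C / p) ∧
      ∀ (g : L → ℝ) (l : ℂ →L[ℝ] ℝ),
        ∫ q, g q.1 * (l q.2 - l q.1) ∂(π : Measure (L × L)) = 0 := by
    intro p hp
    have hp0 : 0 < (p : ℝ) := by
      have : 0 < p := by omega
      exact_mod_cast this
    have : Nonempty (Fin (p - k)) := ⟨⟨0, by omega⟩⟩
    obtain ⟨π, h1, h2, h3⟩ := (hvz p hp).exists_coupling hL (hz p hp)
    refine ⟨π, fun f => by rw [h1, hV p hp, Fintype.card_fin], fun f C hC => ?_, h3⟩
    have := h2 f C hC
    rw [Fintype.card_fin, Fintype.card_fin, Nat.cast_sub hp.le, sub_sub_cancel] at this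
    have heq : ((p : ℝ) - k) / p * (∫ q, f q.2 ∂(π : Measure (L × L))) -
        (p : ℝ)⁻¹ * ∑ i, f (z p i) =
        (((p : ℝ) - k) * (∫ q, f q.2 ∂(π : Measure (L × L))) - ∑ i, f (z p i)) / p := by
      field_simp
    rw [hQ p hp, Nat.cast_sub hp.le, heq, abs_div, abs_of_pos hp0]
    exact div_le_div_of_nonneg_right this hp0.le
  have hex : ∀ p, ∃ π : ProbabilityMeasure (L × L), k < p →
      (∀ f : ℂ → ℝ, ∫ q, f q.1 ∂(π : Measure (L × L)) = ∫ w in L, f w ∂(νV p)) ∧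
      (∀ (f : ℂ → ℝ) (C : ℝ), (∀ x ∈ L, |f x| ≤ C) →
        |((p - k : ℕ) : ℝ) / p * (∫ q, f q.2 ∂(π : Measure (L × L))) - ∫ w in L, f w ∂(νQ p)| ≤
          k * C / p) ∧
      ∀ (g : L → ℝ) (l : ℂ →L[ℝ] ℝ),
        ∫ q, g q.1 * (l q.2 - l q.1) ∂(π : Measure (L × L)) = 0 := by
    intro p
    by_cases hp : k < p
    · obtain ⟨π, hπ⟩ := hcoup p hp
      exact ⟨π, fun _ => hπ⟩
    · obtain ⟨π, -⟩ := hcoup (k + 1) k.lt_succ_self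
      exact ⟨π, fun h => absurd h hp⟩
  choose π hπ using hex
  let U : Ultrafilter ℕ := Ultrafilter.of (atTop ⊓ 𝓟 Γ)
  have hU : (U : Filter ℕ) ≤ atTop ⊓ 𝓟 Γ := Ultrafilter.of_le _
  obtain ⟨ρ, -, hρ⟩ := isCompact_univ.ultrafilter_le_nhds (U.map π) (by simp)
  have hlim : Tendsto π U (𝓝 ρ) := hρ
  have hint := ProbabilityMeasure.tendsto_iff_forall_integral_tendsto.1 hlim
  have hev : ∀ᶠ p in (U : Filter ℕ), k < p :=
    (eventually_gt_atTop k).filter_mono (hU.trans inf_le_left)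
  have hcont : ∀ f : ℂ → ℝ, ContinuousOn f L → Continuous fun x : L => f x :=
    fun f hf => hf.domRestrict
  have hLn : L.Nonempty := ⟨_, hz (k + 1) k.lt_succ_self 0⟩
  refine exists_isDilation_of_coupling hLc hLn hμ.1 ρ (fun f hf => ?_) (fun f hf => ?_)
    fun g l => ?_
  · have h1 := hint (BoundedContinuousFunction.mkOfCompact
      ⟨fun q : L × L => f q.1, (hcont f hf).comp continuous_fst⟩)
    simp only [BoundedContinuousFunction.mkOfCompact_apply, ContinuousMap.coe_mk] at h1
    refine tendsto_nhds_unique h1 (((hμ.2 f hf).mono_left hU).congr' ?_)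
    filter_upwards [hev] with p hp
    exact ((hπ p hp).1 f).symm
  · obtain ⟨C, hC⟩ := hLc.exists_bound_of_continuousOn hf
    have h1 := hint (BoundedContinuousFunction.mkOfCompact
      ⟨fun q : L × L => f q.2, (hcont f hf).comp continuous_snd⟩)
    simp only [BoundedContinuousFunction.mkOfCompact_apply, ContinuousMap.coe_mk] at h1
    have h2 := (((tendsto_sub_div_self k (𝓟 Γ)).mono_left hU).mul h1).sub
      ((hν.2 f hf).mono_left hU)
    rw [one_mul] at h2
    have h3 : Tendsto (fun p : ℕ => k * C / p) U (𝓝 0) :=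
      (tendsto_const_div_atTop_nhds_zero_nat (k * C)).mono_left (hU.trans inf_le_left)
    refine sub_eq_zero.1 (tendsto_nhds_unique h2 (squeeze_zero_norm' ?_ h3))
    filter_upwards [hev] with p hp
    exact (hπ p hp).2.1 f C hC
  · have h1 := hint (BoundedContinuousFunction.mkOfCompact
      ⟨fun q : L × L => g q.1 * (l q.2 - l q.1), by fun_prop⟩)
    simp only [BoundedContinuousFunction.mkOfCompact_apply, ContinuousMap.coe_mk] at h1
    refine tendsto_nhds_unique h1 (tendsto_const_nhds.congr' ?_)
    filter_upwards [hev] with p hp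
    exact ((hπ p hp).2.2 g l).symm

end Limits

end HigherLame

/-! ### The main theorem -/

theorem corollary3p7 (k : ℕ) (hk : 2 ≤ k) (K : Set ℂ) (hK : IsCompact K)
    (Q₂ Q₁ V S : ℕ → Polynomial ℂ) (n : ℕ → ℕ)
    (hQ : ∀ p, k ≤ p → HigherLame.IsLameCoeffs p (Q₂ p) (Q₁ p))
    (hQK : ∀ p, k ≤ p → ∀ z : ℂ, (Q₂ p).IsRoot z → z ∈ K)
    (hVS : ∀ p, k ≤ p →
      HigherLame.IsNormalizedSpectralPair k p (n p) (Q₂ p) (Q₁ p) (V p) (S p)) :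
    -- the root-counting measures live on the convex hull of `K`
    (∀ p, k ≤ p → HigherLame.rootMeasure (Q₂ p) ∈ HigherLame.probOn (convexHull ℝ K)) ∧
    (∀ p, k < p → HigherLame.rootMeasure (V p) ∈ HigherLame.probOn (convexHull ℝ K)) ∧
    -- both weak-* limits exist along a suitable subsequence of any given sequence of `p`'s
    (∀ Γ₀ : Set ℕ, Γ₀.Infinite → ∃ Γ : Set ℕ, Γ ⊆ Γ₀ ∧ Γ.Infinite ∧ ∃ μ ν : Measure ℂ,
      HigherLame.IsWeakStarLimit (convexHull ℝ K) Γ (fun p => HigherLame.rootMeasure (V p)) μ ∧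
      HigherLame.IsWeakStarLimit (convexHull ℝ K) Γ (fun p => HigherLame.rootMeasure (Q₂ p)) ν) ∧
    -- whenever both limits exist, they are related as claimed
    (∀ Γ : Set ℕ, Γ.Infinite → ∀ μ ν : Measure ℂ,
      HigherLame.IsWeakStarLimit (convexHull ℝ K) Γ (fun p => HigherLame.rootMeasure (V p)) μ →
      HigherLame.IsWeakStarLimit (convexHull ℝ K) Γ (fun p => HigherLame.rootMeasure (Q₂ p)) ν →
      HigherLame.ChoquetLE (convexHull ℝ K) μ ν ∧
      (∃ T : ℂ → Measure ℂ, HigherLame.IsDilation (convexHull ℝ K) T ∧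
        HigherLame.IsDilationOf (convexHull ℝ K) T μ ν) ∧
      (∀ m : ℕ, HigherLame.moment μ m ≤ HigherLame.moment ν m) ∧
      (∀ z : ℂ, z ∉ convexHull ℝ K →
        HigherLame.logPotential ν z ≤ HigherLame.logPotential μ z)) := by
  open HigherLame in
  set L := convexHull ℝ K
  have hL : Convex ℝ L := convex_convexHull ℝ K
  have hLc : IsCompact L := HigherLame.isCompact_convexHull hK
  have hLm := hLc.measurableSet
  have hex : ∀ p, ∃ ζ : Fin p → ℂ, k ≤ p →
      (Q₂ p = ∏ l, (Polynomial.X - Polynomial.C (ζ l)) ∧ (∀ l, ζ l ∈ L)) ∧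
      ∃ v : Fin (p - k) → ℂ, V p = ∏ i, (Polynomial.X - Polynomial.C (v i)) ∧ Averages v ζ ∧
        ∀ z e : ℂ, z ∉ L → ∀ b : ℝ, 0 ≤ b → ‖e‖ = 1 →
          (∀ x ∈ L, b ≤ (e / (z - x)).re) →
          b ^ k * ∏ l, ‖z - ζ l‖ ≤ ∏ i, ‖z - v i‖ := by
    intro p
    by_cases hp : k ≤ p
    · obtain ⟨ζ, a, ha, hζ, hQ₁⟩ := (hQ p hp).exists_weightedDerivative
      have hζL : ∀ l, ζ l ∈ L := fun l => subset_convexHull ℝ K <| hQK p hp _ <| by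
        rw [Polynomial.IsRoot, hζ, Polynomial.eval_prod]
        exact Finset.prod_eq_zero (Finset.mem_univ l) (by simp)
      obtain ⟨v, hv, hav, hb⟩ := (hVS p hp).exists_averages (by omega) ha hζ hQ₁
      exact ⟨ζ, fun _ => ⟨⟨hζ, hζL⟩, v, hv, hav, hb L hL hLc.isClosed hζL⟩⟩
    · exact ⟨0, fun h => absurd h hp⟩
  choose ζ hζ using hex
  have hex' : ∀ p, ∃ v : Fin (p - k) → ℂ, k ≤ p →
      V p = ∏ i, (Polynomial.X - Polynomial.C (v i)) ∧ Averages v (ζ p) ∧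
        ∀ z e : ℂ, z ∉ L → ∀ b : ℝ, 0 ≤ b → ‖e‖ = 1 →
          (∀ x ∈ L, b ≤ (e / (z - x)).re) →
          b ^ k * ∏ l, ‖z - ζ p l‖ ≤ ∏ i, ‖z - v i‖ := by
    intro p
    by_cases hp : k ≤ p
    · obtain ⟨v, hv⟩ := (hζ p hp).2
      exact ⟨v, fun _ => hv⟩
    · exact ⟨0, fun h => absurd h hp⟩
  choose v hv using hex'
  have hζL : ∀ p, k ≤ p → ∀ l, ζ p l ∈ L := fun p hp => (hζ p hp).1.2
  have hav : ∀ p, k < p → Averages (v p) (ζ p) := fun p hp => (hv p hp.le).2.1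
  have hvL : ∀ p, k < p → ∀ i, v p i ∈ L := fun p hp => (hav p hp).mem hL (hζL p hp.le)
  have hQr : ∀ p, k ≤ p → rootMeasure (Q₂ p) ∈ probOn L ∧ ∀ f : ℂ → ℝ,
      ∫ w in L, f w ∂(rootMeasure (Q₂ p)) = (p : ℝ)⁻¹ * ∑ i, f (ζ p i) := fun p hp => by
    have : Nonempty (Fin p) := ⟨⟨0, by omega⟩⟩
    rw [(hζ p hp).1.1]
    simpa using rootMeasure_prod hLm (ζ p) (hζL p hp)
  have hVr : ∀ p, k < p → rootMeasure (V p) ∈ probOn L ∧ ∀ f : ℂ → ℝ,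
      ∫ w in L, f w ∂(rootMeasure (V p)) = ((p - k : ℕ) : ℝ)⁻¹ * ∑ i, f (v p i) := fun p hp => by
    have : Nonempty (Fin (p - k)) := ⟨⟨0, by omega⟩⟩
    rw [(hv p hp.le).1]
    have := rootMeasure_prod hLm (v p) (hvL p hp)
    rwa [Fintype.card_fin] at this
  refine ⟨fun p hp => (hQr p hp).1, fun p hp => (hVr p hp).1, fun Γ₀ hΓ₀ =>
    exists_isWeakStarLimit hLc (fun p hp => (hVr p hp).1) (fun p hp => (hQr p hp.le).1) hΓ₀,
    fun Γ hΓ μ ν hμ hν => ?_⟩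
  have hQi := fun p (hp : k < p) => (hQr p hp.le).2
  have hVi := fun p (hp : k < p) => (hVr p hp).2
  have hch : ChoquetLE L μ ν :=
    choquetLE_of_averages hL hLc hΓ (fun p hp => hζL p hp.le) hav hVi hQi hμ hν
  refine ⟨hch, exists_isDilation_of_averages hL hLc hΓ (fun p hp => hζL p hp.le) hav hVi hQi hμ hν,
    fun m => ?_, fun z hz => ?_⟩
  · have := hch (fun w => ‖w‖ ^ m) (by fun_prop)
      ((convexOn_norm hL).pow (fun _ _ => norm_nonneg _) m)
    rwa [restrict_eq_self_of_mem_probOn hμ.1, restrict_eq_self_of_mem_probOn hν.1] at this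
  · obtain ⟨e, b, hb, he, hbL⟩ := exists_le_re_div hL hLc hz
    have hne : ∀ w ∈ L, ‖z - w‖ ≠ 0 := fun w hw =>
      norm_ne_zero_iff.2 (sub_ne_zero.2 fun h => hz (h ▸ hw))
    -- The logarithm of `b^k ∏ |z - ζ_l| ≤ ∏ |z - v_i|` bounds the sums in the reverse direction,
    -- hence the sign `-1`; the constant `k log b` does not depend on `p`.
    have := setIntegral_le_of_sum_le (e := -1) (c := -(k * Real.log b)) hΓ hVi hQi hμ hν
      (f := fun w => Real.log ‖z - w‖) (ContinuousOn.log (by fun_prop) hne) fun p hp => ?_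
    · rw [restrict_eq_self_of_mem_probOn hμ.1, restrict_eq_self_of_mem_probOn hν.1] at this
      simp only [logPotential]
      linarith
    · have h1 := (hv p hp.le).2.2 z e hz b hb.le he hbL
      have hpos : 0 < ∏ l, ‖z - ζ p l‖ := Finset.prod_pos fun l _ =>
        (norm_nonneg _).lt_of_ne' (hne _ (hζL p hp.le l))
      have h2 := Real.log_le_log (by positivity) h1
      rw [Real.log_mul (by positivity) hpos.ne', Real.log_pow,
        Real.log_prod fun l _ => hne _ (hζL p hp.le l),
        Real.log_prod fun i _ => hne _ (hvL p hp i)] at h2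
      linarith
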